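/- Let $M$ be a smooth ($\mathcal C^\infty$) $m$-dimensional manifold, $T:M\to M$ a smooth diffeomorphism and $g:M\to\mathbb C$ a smooth function. A compact set $K\subseteq M$ with $T(K)=K$ is a hyperbolic basic set for $T$ if - it is hyperbolic: there are a smooth Riemannian metric on a neighbourhood of $K$, decompositions $T_xM=E^u_x\oplus E^s_x$ ($x\in K$) with $D_xT(E^i_x)=E^i_{Tx}$ for $i\in\{u,s\}$, and constants $\lambda>1$, $c>0$ such that $\|D_xT^n|_{E^s_x}\|\le c\lambda^{-n}$ and $\|D_xT^{-n}|_{E^u_x}\|\le c\lambda^{-n}$ for all $n\in\mathbb N$, $x\in K$; - it is isolated: $K=\bigcap_{n\in\mathbb Z}T^n(V)$ for some neighbourhood $V$ of $K$; - $T|_K$ is transitive: some point of $K$ has a forward orbit that is dense in $K$. The dynamical determinant of $(T,g)$ on $K$ is the entire function $d_{T,g}$ which is given near $0$ by $$d_{T,g}(z)=\exp\Big(-\sum_{n\ge1}\frac{z^n}{n}\sum_{x\in K,\ T^nx=x}\frac{\prod_{k=0}^{n-1}g(T^kx)}{|\det(I-D_xT^n)|}\Big),$$ where each inner sum is finite.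 The order of an entire function $f$ is $\limsup_{r\to\infty}\log_+\log_+\big(\sup_{|z|\le r}|f(z)|\big)/\log r$, where $\log_+x=\log\max(1,x)$. If $f$ is non-zero of finite order, let $p$ be the least natural number such that $\sum_w|w|^{-p-1}<\infty$, where $w$ runs over the non-zero zeros of $f$ counted with multiplicity, and let $Q$ be the polynomial such that $f(z)=z^{\ell}e^{Q(z)}\prod_wE(z/w,p)$, where $\ell$ is the multiplicity of $0$ as a zero of $f$ and $E(u,p)=(1-u)\exp\big(\sum_{k=1}^pu^k/k\big)$; the genus of $f$ is $\max(\deg Q,p)$. The genus of an entire function of infinite order is $\infty$. Then for every $\gamma\in\mathbb N\cup\{\infty\}$ there are a smooth manifold $M$, a smooth diffeomorphism $T$ of $M$, a hyperbolic basic set $K$ for $T$ and a smooth weight $g:M\to\mathbb C$ such that $d_{T,g}$ has genus $\gamma$. Moreover, for every real $\delta>0$ that is not an integer there are such $M,T,K,g$ for which $d_{T,g}$ has order $\delta$. -/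

import Mathlib

open Set Filter Topology Metric
open scoped Manifold ContDiff

/-! ### Order and genus of an entire function -/

/-- The order of an entire function,
`limsup_{r → ∞} log⁺ log⁺ (sup_{|z| ≤ r} |f z|) / log r`, where `log⁺ x = log (max 1 x)`. -/
noncomputable def entireOrder (f : ℂ → ℂ) : EReal :=
  limsup (fun r : ℝ =>
    ((Real.posLog (Real.posLog (⨆ z : closedBall (0 : ℂ) r, ‖f z‖)) / Real.log r : ℝ) : EReal))
    atTop

/-- The Weierstrass primary factor `E(u, p) = (1 - u) exp (∑_{k=1}^p u^k / k)`. -/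
noncomputable def primaryFactor (p : ℕ) (u : ℂ) : ℂ :=
  (1 - u) * Complex.exp (∑ k ∈ Finset.Icc 1 p, u ^ k / (k : ℂ))

/-- The set of non-zero zeros of `f`. -/
def nonzeroZeros (f : ℂ → ℂ) : Set ℂ := {w | w ≠ 0 ∧ f w = 0}

/-- `∑ 1 / |w|^(p+1)` converges, `w` running over the non-zero zeros of `f` counted with
multiplicity. -/
def ZeroSumConverges (f : ℂ → ℂ) (p : ℕ) : Prop :=
  Summable fun w : nonzeroZeros f => (analyticOrderNatAt f (w : ℂ) : ℝ) / ‖(w : ℂ)‖ ^ (p + 1)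

/-- `f z = z^m e^{Q z} ∏ E(z / w, p)`, where `m` is the multiplicity of `0` as a zero of `f` and `w`
runs over the non-zero zeros of `f` counted with multiplicity. -/
def HasHadamardFactorization (f : ℂ → ℂ) (p : ℕ) (Q : Polynomial ℂ) : Prop :=
  ∀ z : ℂ, ∃ P : ℂ,
    HasProd (fun w : nonzeroZeros f =>
      primaryFactor p (z / (w : ℂ)) ^ analyticOrderNatAt f (w : ℂ)) P ∧
    f z = z ^ analyticOrderNatAt f 0 * Complex.exp (Q.eval z) * P

/-- The entire function `f` has genus `γ`. For `f` non-zero of finite order the genus is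
`max (deg Q) p`, where `p` is the least natural number for which `∑ 1 / |w|^(p+1)` converges and
`Q` is the polynomial of the corresponding Hadamard factorization; a function of infinite order has
infinite genus. -/
def HasGenus (f : ℂ → ℂ) (γ : ℕ∞) : Prop :=
  (entireOrder f = ⊤ ∧ γ = ⊤) ∨
  (entireOrder f ≠ ⊤ ∧ (∃ z, f z ≠ 0) ∧ ∃ (p : ℕ) (Q : Polynomial ℂ),
    IsLeast {q : ℕ | ZeroSumConverges f q} p ∧ HasHadamardFactorization f p Q ∧
    γ = ((max Q.natDegree p : ℕ) : ℕ∞))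

/-! ### Hyperbolic basic sets -/

section Dynamics

variable {m : ℕ} {M : Type*} [TopologicalSpace M] [ChartedSpace (EuclideanSpace ℝ (Fin m)) M]

/-- A smooth Riemannian metric `b` on the open subset `U` of `M` (the values of `b` outside `U` are
irrelevant). -/
structure IsRiemannianMetricOn [IsManifold (𝓡 m) ∞ M]
    (b : ∀ x : M, TangentSpace (𝓡 m) x →L[ℝ] TangentSpace (𝓡 m) x →L[ℝ] ℝ) (U : Set M) :
    Prop where
  isOpen : IsOpen U
  symm : ∀ x ∈ U, ∀ v w : TangentSpace (𝓡 m) x, b x v w = b x w v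
  pos : ∀ x ∈ U, ∀ v : TangentSpace (𝓡 m) x, v ≠ 0 → 0 < b x v v
  contMDiffOn : ContMDiffOn (𝓡 m)
    ((𝓡 m).prod 𝓘(ℝ, EuclideanSpace ℝ (Fin m) →L[ℝ] EuclideanSpace ℝ (Fin m) →L[ℝ] ℝ)) ∞
    (fun x => Bundle.TotalSpace.mk'
      (EuclideanSpace ℝ (Fin m) →L[ℝ] EuclideanSpace ℝ (Fin m) →L[ℝ] ℝ)
      (E := fun x : M => TangentSpace (𝓡 m) x →L[ℝ] TangentSpace (𝓡 m) x →L[ℝ] ℝ) x (b x)) U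

/-- `K` is a hyperbolic set for the diffeomorphism `T`: there are a Riemannian metric on a
neighbourhood of `K`, with norm `|v| = √(b v v)`, and a `DT`-invariant splitting `Es ⊕ Eu` of the
tangent spaces at the points of `K` such that `DT^n` contracts `Es` and `DT^{-n}` contracts `Eu`
exponentially and uniformly. -/
def IsHyperbolicSet [IsManifold (𝓡 m) ∞ M] (T : Diffeomorph (𝓡 m) (𝓡 m) M M ∞) (K : Set M) :
    Prop :=
  ∃ (U : Set M) (b : ∀ x : M, TangentSpace (𝓡 m) x →L[ℝ] TangentSpace (𝓡 m) x →L[ℝ] ℝ)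
    (Es Eu : ∀ x : M, Submodule ℝ (TangentSpace (𝓡 m) x)) (lam c : ℝ),
    K ⊆ U ∧ IsRiemannianMetricOn b U ∧ 1 < lam ∧ 0 < c ∧
    ∀ x ∈ K,
      IsCompl (Eu x) (Es x) ∧
      (Es x).map (mfderiv (𝓡 m) (𝓡 m) T x).toLinearMap = Es (T x) ∧
      (Eu x).map (mfderiv (𝓡 m) (𝓡 m) T x).toLinearMap = Eu (T x) ∧
      (∀ n : ℕ, ∀ v ∈ Es x,
        √(b (T^[n] x) (mfderiv (𝓡 m) (𝓡 m) T^[n] x v) (mfderiv (𝓡 m) (𝓡 m) T^[n] x v))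
          ≤ c * (lam ^ n)⁻¹ * √(b x v v)) ∧
      (∀ n : ℕ, ∀ v ∈ Eu x,
        √(b (T.symm^[n] x) (mfderiv (𝓡 m) (𝓡 m) T.symm^[n] x v)
            (mfderiv (𝓡 m) (𝓡 m) T.symm^[n] x v))
          ≤ c * (lam ^ n)⁻¹ * √(b x v v))

/-- `K` is a hyperbolic basic set for the diffeomorphism `T`: a compact `T`-invariant set which is
hyperbolic, isolated, and on which `T` is transitive (some point of `K` has a forward orbit that is
dense in `K`; in particular `K` is not empty). -/
structure IsHyperbolicBasicSet [IsManifold (𝓡 m) ∞ M]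
    (T : Diffeomorph (𝓡 m) (𝓡 m) M M ∞) (K : Set M) : Prop where
  isCompact : IsCompact K
  invariant : T '' K = K
  hyperbolic : IsHyperbolicSet T K
  isolated : ∃ V ∈ 𝓝ˢ K, K = ⋂ n : ℤ, ⇑((T.toEquiv : Equiv.Perm M) ^ n) '' V
  transitive : ∃ x ∈ K, K ⊆ closure (range fun n : ℕ => T^[n] x)

/-! ### The dynamical determinant -/

/-- `|det (I - D_x F)|` for a fixed point `x` of `F`. The tangent space at `F x`, which is the one at
`x`, is identified with the model space in the same way as the latter. -/
noncomputable def absDetOneSubDeriv (F : M → M) (x : M) : ℝ :=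
  let A : EuclideanSpace ℝ (Fin m) →L[ℝ] EuclideanSpace ℝ (Fin m) := mfderiv (𝓡 m) (𝓡 m) F x
  |LinearMap.det (1 - A).toLinearMap|

/-- The set of the points `x ∈ K` with `T^n x = x`. -/
def periodicPointsIn (T : M → M) (K : Set M) (n : ℕ) : Set M := {x | x ∈ K ∧ T^[n] x = x}

/-- The flat trace
`∑_{x ∈ K, T^n x = x} (∏_{k < n} g (T^k x)) / |det (I - D_x T^n)|`. -/
noncomputable def flatTrace (T : M → M) (K : Set M) (g : M → ℂ) (n : ℕ) : ℂ :=
  ∑ᶠ x ∈ periodicPointsIn T K n,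
    (∏ k ∈ Finset.range n, g (T^[k] x)) / (absDetOneSubDeriv (m := m) T^[n] x : ℂ)

/-- The entire function `d` is the dynamical determinant of `(T, g)` on `K`: near `0` it is equal to
`exp (- ∑_{n ≥ 1} (1 / n) tr_n z^n)`, where `tr_n` is the `n`-th flat trace (a sum over the points of
`K` of period `n`, which are finite in number). -/
structure IsDynamicalDeterminant (T : M → M) (K : Set M) (g : M → ℂ) (d : ℂ → ℂ) : Prop where
  finite_periodicPoints : ∀ n : ℕ, 1 ≤ n → (periodicPointsIn T K n).Finite
  entire : Differentiable ℂ d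
  eq_exp : ∀ᶠ z in 𝓝 (0 : ℂ), ∃ S : ℂ,
    HasSum (fun n : ℕ => (1 / ((n + 1 : ℕ) : ℂ)) * flatTrace (m := m) T K g (n + 1) * z ^ (n + 1))
      S ∧
    d z = Complex.exp (-S)

end Dynamics

/-- `d` is the dynamical determinant of some smooth diffeomorphism `T` of a smooth manifold `M`
(Hausdorff, second countable, without boundary) with a smooth weight `g` on a hyperbolic basic set
`K` for `T`. -/
def IsSmoothDynamicalDeterminant (d : ℂ → ℂ) : Prop :=
  ∃ (m : ℕ) (M : Type) (_ : TopologicalSpace M) (_ : T2Space M) (_ : SecondCountableTopology M)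
    (_ : ChartedSpace (EuclideanSpace ℝ (Fin m)) M) (_ : IsManifold (𝓡 m) ∞ M)
    (T : Diffeomorph (𝓡 m) (𝓡 m) M M ∞) (K : Set M) (g : M → ℂ),
    IsHyperbolicBasicSet T K ∧ ContMDiff (𝓡 m) 𝓘(ℝ, ℂ) ∞ g ∧
    IsDynamicalDeterminant (m := m) T K g d

/-! The map is a linear horseshoe in the plane: on the invariant set, which is coded by the full
shift on two symbols, its derivative is diagonal with entries 9 and 1/9. Hence |det(I - DT^n)| takes
the same value (9^n - 1)(1 - 9^(-n)) at all points of period n, and its inverse is x/(1 - x)^2 = ∑ k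
x^k with x = 9^(-n). Let Z_n be the sum over the points of period n of the products of weights, and
let D(w) = exp(-∑ Z_n w^n / n). Interchanging two summations turns the determinant into the product
of the D(z / 9^k)^k, which is `powProd D`.

The weight is chosen so that D is almost arbitrary. It is 1 where the zeroth symbol is `false`, and
β_j where a `true` is followed by exactly j letters `false` before the next `true`. Cutting cyclic
words at their letters `true` gives a renewal equation (`cyclicSum_sub_one`), whence D(w) = (1 - w)
F(w) with F(w) = 1 - ∑ β_j w^(j+1); the factor 1 - w comes from the word without `true`, of weight
1. The points with gap j have first coordinate at distance of order 9^(-j) from 1, so the weight is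
smooth as soon as β_j decays faster than every exponential, which holds when F is entire. Thus every
entire F with F(0) = 1 is realised (`isSmoothDynamicalDeterminant_powProd`).

It remains to choose F. For F = exp H the zeros are the 9^k with multiplicity k ≥ 1, so p = 0 and
the Hadamard polynomial is ∑ k H(z / 9^k) (`hasGenus_powProd`); H = 0 and H = w^(n+1) give all
finite genera. F = exp(e^(-w) - 1) gives infinite order, and F = ∑ (-w)^n / (n!)^(1/δ) gives order
δ. Upper bounds pass to the product because the scaled arguments decay geometrically
(`norm_powProd_le`); lower bounds are read off on the negative axis, where no factor has modulus
below 1 (`le_norm_powProd`). -/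

namespace Horseshoe

/-! ### The horseshoe diffeomorphism -/

/-- A smooth step, `0` on `(-∞, 1/3]` and `1` on `[2/3, ∞)`. -/
noncomputable def step (x : ℝ) : ℝ := Real.smoothTransition (3 * x - 1)

theorem step_of_le {x : ℝ} (hx : x ≤ 1 / 3) : step x = 0 :=
  Real.smoothTransition.zero_of_nonpos (by linarith)

theorem step_of_ge {x : ℝ} (hx : 2 / 3 ≤ x) : step x = 1 :=
  Real.smoothTransition.one_of_one_le (by linarith)

@[fun_prop]
theorem contDiff_step : ContDiff ℝ ∞ step :=
  Real.smoothTransition.contDiff.comp (by fun_prop)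

/-- The plane. -/
abbrev Plane := EuclideanSpace ℝ (Fin 2)

/-- The horseshoe map. -/
noncomputable def fwd (p : Plane) : Plane :=
  !₂[9 * (p 0 - step (p 0 + p 1)), (p 1 + step (p 0 + p 1)) / 9]

/-- The inverse of the horseshoe map. -/
noncomputable def bwd (p : Plane) : Plane :=
  !₂[p 0 / 9 + step (p 0 / 9 + 9 * p 1), 9 * p 1 - step (p 0 / 9 + 9 * p 1)]

@[simp] theorem fwd_zero (p : Plane) : fwd p 0 = 9 * (p 0 - step (p 0 + p 1)) := rfl
@[simp] theorem fwd_one (p : Plane) : fwd p 1 = (p 1 + step (p 0 + p 1)) / 9 := rfl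
@[simp] theorem bwd_zero (p : Plane) : bwd p 0 = p 0 / 9 + step (p 0 / 9 + 9 * p 1) := rfl
@[simp] theorem bwd_one (p : Plane) : bwd p 1 = 9 * p 1 - step (p 0 / 9 + 9 * p 1) := rfl

theorem plane_ext {p q : Plane} (h0 : p 0 = q 0) (h1 : p 1 = q 1) : p = q := by
  ext i; fin_cases i
  · exact h0
  · exact h1

/-- Moving `step (p 0 + p 1)` from one coordinate to the other preserves the sum `p 0 + p 1`, so the
argument of `step` can be recovered from the image point; this makes the inverse explicit. -/
theorem bwd_fwd (p : Plane) : bwd (fwd p) = p := by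
  have h : fwd p 0 / 9 + 9 * fwd p 1 = p 0 + p 1 := by simp; ring
  apply plane_ext
  · rw [bwd_zero, h]; simp
  · rw [bwd_one, h]; simp; ring

theorem fwd_bwd (p : Plane) : fwd (bwd p) = p := by
  have h : bwd p 0 + bwd p 1 = p 0 / 9 + 9 * p 1 := by simp
  apply plane_ext
  · rw [fwd_zero, h]; simp; ring
  · rw [fwd_one, h]; simp

theorem contDiff_fwd : ContDiff ℝ ∞ fwd := by
  refine contDiff_euclidean.2 fun i => ?_
  fin_cases i
  · change ContDiff ℝ ∞ fun p : Plane => 9 * (p 0 - step (p 0 + p 1))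
    fun_prop
  · change ContDiff ℝ ∞ fun p : Plane => (p 1 + step (p 0 + p 1)) / 9
    fun_prop

theorem contDiff_bwd : ContDiff ℝ ∞ bwd := by
  refine contDiff_euclidean.2 fun i => ?_
  fin_cases i
  · change ContDiff ℝ ∞ fun p : Plane => p 0 / 9 + step (p 0 / 9 + 9 * p 1)
    fun_prop
  · change ContDiff ℝ ∞ fun p : Plane => 9 * p 1 - step (p 0 / 9 + 9 * p 1)
    fun_prop

/-- The horseshoe map as a diffeomorphism of the plane. -/
noncomputable def horseshoeMap : Diffeomorph (𝓡 2) (𝓡 2) Plane Plane ∞ where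
  toFun := fwd
  invFun := bwd
  left_inv := bwd_fwd
  right_inv := fwd_bwd
  contMDiff_toFun := contDiff_fwd.contMDiff
  contMDiff_invFun := contDiff_bwd.contMDiff

@[simp] theorem coe_horseshoeMap : ⇑horseshoeMap = fwd := rfl
@[simp] theorem coe_horseshoeMap_symm : ⇑horseshoeMap.symm = bwd := rfl

/-! ### Symbolic coding -/

/-- The digit of a symbol. -/
def digit (a : Bool) : ℝ := if a then 1 else 0

@[simp] theorem digit_true : digit true = 1 := rfl
@[simp] theorem digit_false : digit false = 0 := rfl

theorem digit_nonneg (a : Bool) : 0 ≤ digit a := by cases a <;> simp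
theorem digit_le_one (a : Bool) : digit a ≤ 1 := by cases a <;> simp

/-- The number with the base `9` expansion `x`, with `x 0` before the point. -/
noncomputable def expand (x : ℕ → Bool) : ℝ := ∑' k, digit (x k) * (1 / 9 : ℝ) ^ k

theorem norm_digit_mul_le (x : ℕ → Bool) (k : ℕ) :
    ‖digit (x k) * (1 / 9 : ℝ) ^ k‖ ≤ (1 / 9 : ℝ) ^ k := by
  rw [Real.norm_of_nonneg (mul_nonneg (digit_nonneg _) (by positivity))]
  exact mul_le_of_le_one_left (by positivity) (digit_le_one _)

theorem summable_digit (x : ℕ → Bool) : Summable fun k => digit (x k) * (1 / 9 : ℝ) ^ k :=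
  Summable.of_norm_bounded (summable_geometric_of_lt_one (by norm_num) (by norm_num))
    (norm_digit_mul_le x)

theorem expand_eq (x : ℕ → Bool) : expand x = digit (x 0) + expand (fun k => x (k + 1)) / 9 := by
  rw [expand, (summable_digit x).tsum_eq_zero_add, expand, ← tsum_div_const]
  congr 1
  · simp
  · refine tsum_congr fun k => ?_
    rw [pow_succ]; ring

theorem expand_nonneg (x : ℕ → Bool) : 0 ≤ expand x :=
  tsum_nonneg fun _ => mul_nonneg (digit_nonneg _) (by positivity)

theorem expand_le (x : ℕ → Bool) : expand x ≤ 9 / 8 := by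
  have h : ∑' k : ℕ, (1 / 9 : ℝ) ^ k = 9 / 8 := by
    rw [tsum_geometric_of_lt_one (by norm_num) (by norm_num)]; norm_num
  rw [← h]
  exact (summable_digit x).tsum_le_tsum
    (fun k => (le_abs_self _).trans (norm_digit_mul_le x k))
    (summable_geometric_of_lt_one (by norm_num) (by norm_num))

theorem continuous_digit : Continuous digit := continuous_of_discreteTopology

theorem continuous_expand : Continuous expand :=
  continuous_tsum (fun k => (continuous_digit.comp (continuous_apply k)).mul continuous_const)
    (summable_geometric_of_lt_one (by norm_num) (by norm_num))
    (fun k x => norm_digit_mul_le x k)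

/-- The point of the horseshoe with the itinerary `s`. -/
noncomputable def code (s : ℤ → Bool) : Plane :=
  !₂[expand (fun k => s k), expand (fun k => s (-1 - k)) / 9]

@[simp] theorem code_zero (s : ℤ → Bool) : code s 0 = expand (fun k => s k) := rfl
@[simp] theorem code_one (s : ℤ → Bool) : code s 1 = expand (fun k => s (-1 - k)) / 9 := rfl

theorem continuous_code : Continuous code := by
  refine (PiLp.continuous_toLp 2 _).comp (continuous_pi fun i => ?_)
  fin_cases i
  · exact continuous_expand.comp (by fun_prop)
  · exact (continuous_expand.comp (by fun_prop)).div_const 9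

/-- The horseshoe. -/
def horseshoe : Set Plane := range code

theorem isCompact_horseshoe : IsCompact horseshoe := isCompact_range continuous_code

/-- In base 9 with digits 0 and 1 each tail contributes at most 1/8. The sum of coordinates
therefore stays away from [1/3, 2/3], outside which `step` is locally constant. -/
theorem code_sum_of_false {s : ℤ → Bool} (h : s 0 = false) :
    0 ≤ code s 0 + code s 1 ∧ code s 0 + code s 1 ≤ 1 / 4 := by
  have h1 := expand_eq (fun k => s k)
  have h2 := expand_le (fun k => s (k + 1 : ℕ))
  have h3 := expand_le (fun k => s (-1 - k))
  have h4 := expand_nonneg (fun k => s (k + 1 : ℕ))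
  have h5 := expand_nonneg (fun k => s (-1 - k))
  simp only [Nat.cast_zero, h, digit_false] at h1
  rw [code_zero, code_one, h1]
  constructor <;> linarith

theorem code_sum_of_true {s : ℤ → Bool} (h : s 0 = true) :
    1 ≤ code s 0 + code s 1 ∧ code s 0 + code s 1 ≤ 5 / 4 := by
  have h1 := expand_eq (fun k => s k)
  have h2 := expand_le (fun k => s (k + 1 : ℕ))
  have h3 := expand_le (fun k => s (-1 - k))
  have h4 := expand_nonneg (fun k => s (k + 1 : ℕ))
  have h5 := expand_nonneg (fun k => s (-1 - k))
  simp only [Nat.cast_zero, h, digit_true] at h1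
  rw [code_zero, code_one, h1]
  constructor <;> linarith

theorem step_code (s : ℤ → Bool) : step (code s 0 + code s 1) = digit (s 0) := by
  cases h : s 0
  · exact step_of_le (by linarith [(code_sum_of_false h).2])
  · exact step_of_ge (by linarith [(code_sum_of_true h).1])

/-- The zeroth digit is removed from the expansion of the future and becomes the leading digit of
the expansion of the past: the map acts as the shift. -/
theorem fwd_code (s : ℤ → Bool) : fwd (code s) = code (fun k => s (k + 1)) := by
  apply plane_ext
  · rw [fwd_zero, step_code]
    have h1 := expand_eq (fun k => s k)
    simp only [code_zero]
    rw [h1]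
    push_cast
    ring
  · rw [fwd_one, step_code]
    have h1 := expand_eq (fun k => s (-1 - k + 1))
    simp only [code_one]
    rw [h1]
    have : (fun k : ℕ => s (-1 - ((k + 1 : ℕ) : ℤ) + 1)) = fun k : ℕ => s (-1 - (k : ℤ)) := by
      ext k; congr 1; push_cast; ring
    rw [this]
    simp
    ring

theorem bwd_code (s : ℤ → Bool) : bwd (code s) = code (fun k => s (k - 1)) := by
  have h : code s = fwd (code (fun k => s (k - 1))) := by simp [fwd_code]
  rw [h, bwd_fwd]

theorem iterate_fwd_code (n : ℕ) (s : ℤ → Bool) :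
    fwd^[n] (code s) = code (fun k => s (k + n)) := by
  induction n generalizing s with
  | zero => simp
  | succ n ih =>
    rw [Function.iterate_succ_apply, fwd_code, ih]
    congr 1; ext k; congr 1; push_cast; ring

theorem iterate_bwd_code (n : ℕ) (s : ℤ → Bool) :
    bwd^[n] (code s) = code (fun k => s (k - n)) := by
  induction n generalizing s with
  | zero => simp
  | succ n ih =>
    rw [Function.iterate_succ_apply, bwd_code, ih]
    congr 1; ext k; congr 1; push_cast; ring

/-- The zeroth symbol is read off through `step`, and every other symbol becomes the zeroth one
after iterating `fwd` or `bwd`. -/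
theorem code_injective : Function.Injective code := by
  have hd : ∀ {a b : Bool}, digit a = digit b → a = b := by
    intro a b; cases a <;> cases b <;> simp
  intro s t h
  ext1 k
  obtain ⟨n, rfl | rfl⟩ := k.eq_nat_or_neg
  · have h1 : fwd^[n] (code s) = fwd^[n] (code t) := by rw [h]
    rw [iterate_fwd_code, iterate_fwd_code] at h1
    have h2 := step_code fun k => s (k + n)
    rw [h1, step_code] at h2
    simpa using (hd h2).symm
  · have h1 : bwd^[n] (code s) = bwd^[n] (code t) := by rw [h]
    rw [iterate_bwd_code, iterate_bwd_code] at h1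
    have h2 := step_code fun k => s (k - n)
    rw [h1, step_code] at h2
    simpa using (hd h2).symm

theorem image_horseshoe : horseshoeMap '' horseshoe = horseshoe := by
  ext p
  constructor
  · rintro ⟨_, ⟨s, rfl⟩, rfl⟩
    exact ⟨_, (fwd_code s).symm⟩
  · rintro ⟨s, rfl⟩
    exact ⟨_, ⟨fun k => s (k - 1), rfl⟩, by simp [fwd_code]⟩

/-! ### Isolation -/

/-- An isolating neighbourhood of the horseshoe. -/
def isolatingNhd : Set Plane :=
  {p | |p 0| < 3 ∧ |p 1| < 3 ∧ (p 0 + p 1 < 1 / 3 ∨ 2 / 3 < p 0 + p 1)}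

theorem isOpen_isolatingNhd : IsOpen isolatingNhd := by
  have h0 : Continuous fun p : Plane => p 0 := by fun_prop
  have h1 : Continuous fun p : Plane => p 1 := by fun_prop
  exact (isOpen_lt h0.abs continuous_const).inter ((isOpen_lt h1.abs continuous_const).inter
    ((isOpen_lt (h0.add h1) continuous_const).union (isOpen_lt continuous_const (h0.add h1))))

theorem code_mem_isolatingNhd (s : ℤ → Bool) : code s ∈ isolatingNhd := by
  have h2 := expand_le (fun k => s k)
  have h3 := expand_le (fun k => s (-1 - k))
  have h4 := expand_nonneg (fun k => s k)
  have h5 := expand_nonneg (fun k => s (-1 - k))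
  refine ⟨?_, ?_, ?_⟩
  · rw [code_zero, abs_lt]; constructor <;> linarith
  · rw [code_one, abs_lt]; constructor <;> linarith
  · cases h : s 0
    · exact .inl (by linarith [(code_sum_of_false h).2])
    · exact .inr (by linarith [(code_sum_of_true h).1])

theorem eq_zero_of_expanding {e : ℕ → ℝ} {C : ℝ} (h : ∀ n, e (n + 1) = 9 * e n)
    (hC : ∀ n, |e n| ≤ C) : e 0 = 0 := by
  have hn : ∀ n, e n = 9 ^ n * e 0 := by
    intro n
    induction n with
    | zero => simp
    | succ n ih => rw [h, ih, pow_succ]; ring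
  by_contra h0
  have h0 : 0 < |e 0| := abs_pos.2 h0
  obtain ⟨n, hn'⟩ := pow_unbounded_of_one_lt (C / |e 0|) (by norm_num : (1 : ℝ) < 9)
  rw [div_lt_iff₀ h0] at hn'
  have := hC n
  rw [hn, abs_mul, abs_of_pos (by positivity : (0 : ℝ) < 9 ^ n)] at this
  linarith

/-- The symbol of a point of the isolating neighbourhood. -/
noncomputable def symbol (p : Plane) : Bool := decide (2 / 3 < p 0 + p 1)

theorem step_eq_digit_symbol {p : Plane} (hp : p ∈ isolatingNhd) :
    step (p 0 + p 1) = digit (symbol p) := by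
  unfold symbol
  obtain ⟨-, -, h | h⟩ := hp
  · rw [step_of_le h.le, decide_eq_false (by linarith)]; rfl
  · rw [step_of_ge h.le, decide_eq_true h]; rfl

/-- The given orbit and the coded orbit with the same itinerary obey the same affine recursion.
Their difference is multiplied by 9 in the first coordinate forwards and in the second coordinate
backwards; being bounded, it vanishes. -/
theorem mem_horseshoe_of_orbit_mem {o : ℤ → Plane} (ho : ∀ n, o (n + 1) = fwd (o n))
    (hV : ∀ n, o n ∈ isolatingNhd) : o 0 ∈ horseshoe := by
  set s : ℤ → Bool := fun n => symbol (o n) with hs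
  have hstep : ∀ n, step (o n 0 + o n 1) = digit (s n) := fun n => step_eq_digit_symbol (hV n)
  have h0 : ∀ n, o (n + 1) 0 = 9 * (o n 0 - digit (s n)) := fun n => by
    rw [ho, fwd_zero, hstep]
  have h1 : ∀ n, o (n + 1) 1 = (o n 1 + digit (s n)) / 9 := fun n => by
    rw [ho, fwd_one, hstep]
  have hsh : ∀ n : ℤ, (fun k => s (k + (n + 1))) = fun k => s (k + 1 + n) := fun n => by
    ext k; congr 1; ring
  have c0 : ∀ n : ℤ, code (fun k => s (k + (n + 1))) 0 =
      9 * (code (fun k => s (k + n)) 0 - digit (s n)) := fun n => by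
    have h := fwd_zero (code fun k => s (k + n))
    rw [step_code, fwd_code] at h
    simp only [zero_add] at h
    rw [← h, hsh]
  have c1 : ∀ n : ℤ, code (fun k => s (k + (n + 1))) 1 =
      (code (fun k => s (k + n)) 1 + digit (s n)) / 9 := fun n => by
    have h := fwd_one (code fun k => s (k + n))
    rw [step_code, fwd_code] at h
    simp only [zero_add] at h
    rw [← h, hsh]
  refine ⟨s, plane_ext ?_ ?_⟩
  -- Both orbits lie in `isolatingNhd`, where coordinates are below 3 in modulus; hence the bound 6.
  · have := eq_zero_of_expanding
      (e := fun n : ℕ => code (fun k => s (k + n)) 0 - o n 0) (C := 6) (fun n => by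
        push_cast; rw [h0, c0]; ring) (fun n => by
        have a := (code_mem_isolatingNhd fun k => s (k + n)).1
        have b := (hV n).1
        exact (abs_sub _ _).trans (by linarith))
    simpa [sub_eq_zero] using this
  · have := eq_zero_of_expanding
      (e := fun n : ℕ => code (fun k => s (k + -n)) 1 - o (-n) 1) (C := 6) (fun n => by
        have a := h1 (-(n + 1 : ℕ))
        have b := c1 (-(n + 1 : ℕ))
        have e : (-((n + 1 : ℕ) : ℤ) + 1) = -n := by push_cast; ring
        rw [e] at a b
        rw [a, b]; ring) (fun n => by
        have a := (code_mem_isolatingNhd fun k => s (k + -n)).2.1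
        have b := (hV (-n)).2.1
        exact (abs_sub _ _).trans (by linarith))
    simpa [sub_eq_zero] using this

theorem isolated_horseshoe :
    ∃ V ∈ 𝓝ˢ horseshoe, horseshoe = ⋂ n : ℤ, ⇑((horseshoeMap.toEquiv : Equiv.Perm Plane) ^ n) '' V := by
  set e : Equiv.Perm Plane := horseshoeMap.toEquiv with he
  have hsub : horseshoe ⊆ isolatingNhd := by rintro _ ⟨s, rfl⟩; exact code_mem_isolatingNhd s
  refine ⟨isolatingNhd, isOpen_isolatingNhd.mem_nhdsSet.2 hsub, ?_⟩
  have hmem : ∀ (n : ℤ) (p : Plane), p ∈ ⇑(e ^ n) '' isolatingNhd ↔ (e ^ (-n)) p ∈ isolatingNhd := by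
    intro n p
    rw [Equiv.image_eq_preimage_symm, mem_preimage, zpow_neg]
    rfl
  have hcode : ∀ (n : ℤ) (s : ℤ → Bool), (e ^ n) (code s) = code (fun k => s (k + n)) := by
    intro n s
    obtain ⟨n, rfl | rfl⟩ := n.eq_nat_or_neg
    · rw [zpow_natCast, Equiv.Perm.coe_pow]
      exact iterate_fwd_code n s
    · rw [zpow_neg, Equiv.Perm.inv_eq_iff_eq, zpow_natCast, Equiv.Perm.coe_pow]
      change code s = fwd^[n] _
      rw [iterate_fwd_code]
      congr 1; ext k; congr 1; ring
  ext p
  simp only [mem_iInter, hmem]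
  constructor
  · rintro ⟨s, rfl⟩ n
    rw [hcode]
    exact code_mem_isolatingNhd _
  · intro h
    have := mem_horseshoe_of_orbit_mem (o := fun n => (e ^ n) p)
      (fun n => by rw [add_comm, zpow_add, zpow_one]; rfl) (fun n => by simpa using h (-n))
    simpa using this

/-! ### Transitivity -/

/-- A sequence in which every finite word occurs. -/
def richSequence (k : ℤ) : Bool :=
  Nat.testBit (Nat.log 2 k.toNat) (k.toNat - 2 ^ Nat.log 2 k.toNat)

/-- For 2^m ≤ k < 2^(m+1) the symbol at k is the bit of m at position k - 2^m, so the binary digits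
of m are written out from position 2^m on. -/
theorem exists_richSequence_eq (w : ℕ → Bool) (L : ℕ) :
    ∃ N : ℕ, ∀ i < L, richSequence ((N + i : ℕ) : ℤ) = w i := by
  set a := Nat.ofBits (fun i : Fin L => w i) with ha
  -- Adding 2^L to the number a encoding the word leaves its lowest L bits unchanged and makes the
  -- block long enough to contain L letters.
  refine ⟨2 ^ (2 ^ L + a), fun i hi => ?_⟩
  have h1 : i < 2 ^ (2 ^ L + a) :=
    calc i < L := hi
      _ < 2 ^ L := Nat.lt_two_pow_self
      _ ≤ 2 ^ L + a := Nat.le_add_right _ _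
      _ < 2 ^ (2 ^ L + a) := Nat.lt_two_pow_self
  have h2 : Nat.log 2 (2 ^ (2 ^ L + a) + i) = 2 ^ L + a := by
    rw [Nat.log_eq_iff (by right; constructor <;> simp)]
    constructor
    · omega
    · rw [pow_succ]; omega
  simp only [richSequence, Int.toNat_natCast, h2, Nat.add_sub_cancel_left]
  rw [Nat.testBit_two_pow_add_gt hi, ha, Nat.testBit_ofBits_lt _ _ hi]

theorem transitive_horseshoe :
    ∃ x ∈ horseshoe, horseshoe ⊆ closure (range fun n : ℕ => horseshoeMap^[n] x) := by
  refine ⟨code richSequence, ⟨_, rfl⟩, ?_⟩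
  rintro _ ⟨s, rfl⟩
  have hN : ∀ L : ℕ, ∃ N : ℕ, ∀ i < 2 * L + 1,
      richSequence ((N + i : ℕ) : ℤ) = s ((i : ℤ) - L) := fun L =>
    exists_richSequence_eq (fun i => s ((i : ℤ) - L)) (2 * L + 1)
  choose N hN using hN
  -- Shifted by N L + L, the rich sequence agrees with s on [-L, L], so the shifts converge to s
  -- coordinatewise.
  refine mem_closure_of_tendsto (f := fun L : ℕ => code (fun k => richSequence (k + (N L + L : ℕ))))
    (b := atTop) ?_ (.of_forall fun L => ⟨N L + L, ?_⟩)
  · refine (continuous_code.tendsto s).comp (tendsto_pi_nhds.2 fun k => ?_)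
    refine tendsto_const_nhds.congr' ?_
    filter_upwards [eventually_ge_atTop k.natAbs] with L hL
    have h := hN L (k + L).toNat (by omega)
    have h1 : (((k + L).toNat : ℕ) : ℤ) = k + L := Int.toNat_of_nonneg (by omega)
    push_cast at h
    rw [h1] at h
    rw [add_sub_cancel_right] at h
    rw [← h]
    congr 1
    push_cast
    ring
  · exact iterate_fwd_code _ _

end Horseshoe

namespace Horseshoe

/-! ### Derivatives along the horseshoe -/

/-- The diagonal linear map of the plane with the entries `a` and `b`. -/
noncomputable def diagMap (a b : ℝ) : Plane →L[ℝ] Plane :=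
  Matrix.toEuclideanCLM (n := Fin 2) (𝕜 := ℝ) (Matrix.diagonal ![a, b])

@[simp] theorem diagMap_zero (a b : ℝ) (v : Plane) : diagMap a b v 0 = a * v 0 := by
  simp [diagMap, Matrix.ofLp_toEuclideanCLM, Matrix.mulVec_diagonal]

@[simp] theorem diagMap_one (a b : ℝ) (v : Plane) : diagMap a b v 1 = b * v 1 := by
  simp [diagMap, Matrix.ofLp_toEuclideanCLM, Matrix.mulVec_diagonal]

theorem det_one_sub_diagMap (a b : ℝ) :
    LinearMap.det (1 - diagMap a b).toLinearMap = (1 - a) * (1 - b) := by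
  have h : (1 - diagMap a b).toLinearMap =
      Matrix.toLpLin 2 2 (Matrix.diagonal ![1 - a, 1 - b]) := by
    refine LinearMap.ext fun v => plane_ext ?_ ?_
    · simp [Matrix.mulVec_diagonal]; ring
    · simp [Matrix.mulVec_diagonal]; ring
  rw [h, LinearMap.det_toLpLin, Matrix.det_diagonal]
  simp

theorem diagMap_comp (a b a' b' : ℝ) :
    (diagMap a b).comp (diagMap a' b') = diagMap (a * a') (b * b') := by
  refine ContinuousLinearMap.ext fun v => plane_ext ?_ ?_ <;> simp [mul_assoc]

theorem diagMap_one_one : diagMap 1 1 = ContinuousLinearMap.id ℝ Plane := by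
  refine ContinuousLinearMap.ext fun v => plane_ext ?_ ?_ <;> simp

/-- Consequently the map is affine near each point of the horseshoe, always with the same linear
part. -/
theorem step_eventuallyEq {s : ℤ → Bool} :
    ∀ᶠ p : Plane in 𝓝 (code s), step (p 0 + p 1) = digit (s 0) := by
  have h0 : Continuous fun p : Plane => p 0 + p 1 := by fun_prop
  cases h : s 0
  · have := (code_sum_of_false h).2
    filter_upwards [(isOpen_lt h0 continuous_const).mem_nhds
      (show code s 0 + code s 1 < 1 / 3 by linarith)] with p hp
    exact step_of_le (le_of_lt hp)
  · have := (code_sum_of_true h).1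
    filter_upwards [(isOpen_lt continuous_const h0).mem_nhds
      (show 2 / 3 < code s 0 + code s 1 by linarith)] with p hp
    exact step_of_ge (le_of_lt hp)

theorem hasFDerivAt_fwd (s : ℤ → Bool) : HasFDerivAt fwd (diagMap 9 (1 / 9)) (code s) := by
  have h : HasFDerivAt (fun p : Plane => diagMap 9 (1 / 9) p +
      (!₂[-(9 * digit (s 0)), digit (s 0) / 9] : Plane)) (diagMap 9 (1 / 9)) (code s) :=
    (diagMap 9 (1 / 9)).hasFDerivAt.add_const _
  refine h.congr_of_eventuallyEq ?_
  filter_upwards [step_eventuallyEq (s := s)] with p hp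
  apply plane_ext
  · rw [fwd_zero, hp]; simp; ring
  · rw [fwd_one, hp]; simp; ring

theorem hasFDerivAt_iterate_fwd (n : ℕ) (s : ℤ → Bool) :
    HasFDerivAt fwd^[n] (diagMap (9 ^ n) ((1 / 9) ^ n)) (code s) := by
  induction n generalizing s with
  | zero => simpa [diagMap_one_one] using hasFDerivAt_id (code s)
  | succ n ih =>
    have h1 := ih (fun k => s (k + 1))
    rw [← fwd_code] at h1
    have := h1.comp (code s) (hasFDerivAt_fwd s)
    rwa [diagMap_comp, ← pow_succ, ← pow_succ] at this

theorem hasFDerivAt_bwd (s : ℤ → Bool) : HasFDerivAt bwd (diagMap (1 / 9) 9) (code s) := by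
  have hb := (contDiff_bwd.differentiable (by simp) (code s)).hasFDerivAt
  have h1 : HasFDerivAt fwd (diagMap 9 (1 / 9)) (bwd (code s)) := by
    rw [bwd_code]; exact hasFDerivAt_fwd _
  have h2 := h1.comp (code s) hb
  have h3 : fwd ∘ bwd = id := funext fwd_bwd
  rw [h3] at h2
  have h4 := h2.unique (hasFDerivAt_id (code s))
  have h5 : fderiv ℝ bwd (code s) = diagMap (1 / 9) 9 := by
    calc fderiv ℝ bwd (code s)
        = (diagMap (1 / 9) 9).comp ((diagMap 9 (1 / 9)).comp (fderiv ℝ bwd (code s))) := by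
          rw [← ContinuousLinearMap.comp_assoc, diagMap_comp]; norm_num [diagMap_one_one]
      _ = diagMap (1 / 9) 9 := by rw [h4]; simp
  rwa [h5] at hb

theorem hasFDerivAt_iterate_bwd (n : ℕ) (s : ℤ → Bool) :
    HasFDerivAt bwd^[n] (diagMap ((1 / 9) ^ n) (9 ^ n)) (code s) := by
  induction n generalizing s with
  | zero => simpa [diagMap_one_one] using hasFDerivAt_id (code s)
  | succ n ih =>
    have h1 := ih (fun k => s (k - 1))
    rw [← bwd_code] at h1
    have := h1.comp (code s) (hasFDerivAt_bwd s)
    rwa [diagMap_comp, ← pow_succ, ← pow_succ] at this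

theorem mfderiv_fwd (s : ℤ → Bool) : mfderiv (𝓡 2) (𝓡 2) fwd (code s) = diagMap 9 (1 / 9) := by
  rw [mfderiv_eq_fderiv]; exact (hasFDerivAt_fwd s).fderiv

theorem mfderiv_iterate_fwd (n : ℕ) (s : ℤ → Bool) :
    mfderiv (𝓡 2) (𝓡 2) fwd^[n] (code s) = diagMap (9 ^ n) ((1 / 9) ^ n) := by
  rw [mfderiv_eq_fderiv]; exact (hasFDerivAt_iterate_fwd n s).fderiv

theorem mfderiv_iterate_bwd (n : ℕ) (s : ℤ → Bool) :
    mfderiv (𝓡 2) (𝓡 2) bwd^[n] (code s) = diagMap ((1 / 9) ^ n) (9 ^ n) := by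
  rw [mfderiv_eq_fderiv]; exact (hasFDerivAt_iterate_bwd n s).fderiv

theorem absDetOneSubDeriv_iterate_fwd (n : ℕ) (s : ℤ → Bool) :
    absDetOneSubDeriv (m := 2) fwd^[n] (code s) = (9 ^ n - 1) * (1 - (1 / 9) ^ n) := by
  have h : absDetOneSubDeriv (m := 2) fwd^[n] (code s) =
      |LinearMap.det (1 - diagMap (9 ^ n) ((1 / 9) ^ n)).toLinearMap| := by
    unfold absDetOneSubDeriv
    rw [mfderiv_iterate_fwd]
  have h1 : (1 : ℝ) ≤ 9 ^ n := one_le_pow₀ (by norm_num)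
  have h2 : (1 / 9 : ℝ) ^ n ≤ 1 := pow_le_one₀ (by norm_num) (by norm_num)
  rw [h, det_one_sub_diagMap, abs_mul, abs_of_nonpos (by linarith), abs_of_nonneg (by linarith)]
  ring

/-! ### Hyperbolicity -/

/-- The vertical axis. -/
noncomputable def stableAxis : Submodule ℝ Plane :=
  LinearMap.ker (EuclideanSpace.proj (𝕜 := ℝ) (0 : Fin 2) : Plane →L[ℝ] ℝ).toLinearMap

/-- The horizontal axis. -/
noncomputable def unstableAxis : Submodule ℝ Plane :=
  LinearMap.ker (EuclideanSpace.proj (𝕜 := ℝ) (1 : Fin 2) : Plane →L[ℝ] ℝ).toLinearMap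

theorem mem_stableAxis {v : Plane} : v ∈ stableAxis ↔ v 0 = 0 := Iff.rfl
theorem mem_unstableAxis {v : Plane} : v ∈ unstableAxis ↔ v 1 = 0 := Iff.rfl

theorem isCompl_axes : IsCompl unstableAxis stableAxis := by
  constructor
  · rw [Submodule.disjoint_def]
    intro v h1 h0
    exact plane_ext h0 h1
  · rw [Submodule.codisjoint_iff_exists_add_eq]
    intro v
    refine ⟨!₂[v 0, 0], !₂[0, v 1], rfl, rfl, plane_ext ?_ ?_⟩ <;> simp

theorem map_stableAxis {a b : ℝ} (hb : b ≠ 0) :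
    stableAxis.map (diagMap a b).toLinearMap = stableAxis := by
  ext v
  constructor
  · rintro ⟨w, hw, rfl⟩
    have hw : w 0 = 0 := hw
    exact mem_stableAxis.2 (by simp [hw])
  · intro hv
    have hv : v 0 = 0 := hv
    refine ⟨!₂[0, v 1 / b], rfl, plane_ext ?_ ?_⟩
    · simp [hv]
    · simp; field_simp

theorem map_unstableAxis {a b : ℝ} (ha : a ≠ 0) :
    unstableAxis.map (diagMap a b).toLinearMap = unstableAxis := by
  ext v
  constructor
  · rintro ⟨w, hw, rfl⟩
    have hw : w 1 = 0 := hw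
    exact mem_unstableAxis.2 (by simp [hw])
  · intro hv
    have hv : v 1 = 0 := hv
    refine ⟨!₂[v 0 / a, 0], rfl, plane_ext ?_ ?_⟩
    · simp; field_simp
    · simp [hv]

theorem diagMap_of_mem_stableAxis (a b : ℝ) {v : Plane} (hv : v ∈ stableAxis) :
    diagMap a b v = b • v := by
  have hv : v 0 = 0 := hv
  apply plane_ext <;> simp [hv]

theorem diagMap_of_mem_unstableAxis (a b : ℝ) {v : Plane} (hv : v ∈ unstableAxis) :
    diagMap a b v = a • v := by
  have hv : v 1 = 0 := hv
  apply plane_ext <;> simp [hv]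

theorem sqrt_inner_smul_le (n : ℕ) {v w : Plane} (h : w = (1 / 9 : ℝ) ^ n • v) :
    √(innerSL ℝ w w) ≤ 1 * ((9 : ℝ) ^ n)⁻¹ * √(innerSL ℝ v v) := by
  subst h
  simp only [innerSL_apply_apply, real_inner_self_eq_norm_sq]
  rw [Real.sqrt_sq (norm_nonneg _), Real.sqrt_sq (norm_nonneg _), norm_smul, norm_pow]
  simp

theorem isRiemannianMetricOn_inner :
    IsRiemannianMetricOn (m := 2) (M := Plane)
      (fun _ => (innerSL ℝ : Plane →L[ℝ] Plane →L[ℝ] ℝ)) univ where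
  isOpen := isOpen_univ
  symm _ _ v w := real_inner_comm (F := Plane) w v
  pos _ _ _ hv := real_inner_self_pos (F := Plane).2 hv
  contMDiffOn := ((riemannianMetricVectorSpace Plane).contMDiff.of_le le_top).contMDiffOn

theorem isHyperbolicSet_horseshoe : IsHyperbolicSet horseshoeMap horseshoe := by
  refine ⟨univ, fun _ => (innerSL ℝ : Plane →L[ℝ] Plane →L[ℝ] ℝ), fun _ => stableAxis,
    fun _ => unstableAxis, 9, 1, subset_univ _, isRiemannianMetricOn_inner, by norm_num,
    by norm_num, ?_⟩
  rintro _ ⟨s, rfl⟩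
  refine ⟨isCompl_axes, ?_, ?_, fun n v hv => ?_, fun n v hv => ?_⟩
  · rw [coe_horseshoeMap, mfderiv_fwd]; exact map_stableAxis (by norm_num)
  · rw [coe_horseshoeMap, mfderiv_fwd]; exact map_unstableAxis (by norm_num)
  · rw [coe_horseshoeMap, mfderiv_iterate_fwd]
    exact sqrt_inner_smul_le n (diagMap_of_mem_stableAxis _ _ hv)
  · rw [coe_horseshoeMap_symm, mfderiv_iterate_bwd]
    exact sqrt_inner_smul_le n (diagMap_of_mem_unstableAxis _ _ hv)

theorem isHyperbolicBasicSet_horseshoe : IsHyperbolicBasicSet horseshoeMap horseshoe where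
  isCompact := isCompact_horseshoe
  invariant := image_horseshoe
  hyperbolic := isHyperbolicSet_horseshoe
  isolated := isolated_horseshoe
  transitive := transitive_horseshoe

end Horseshoe

namespace Horseshoe

/-! ### Sums over words -/

/-- The position of the first `true` in the word `w`, followed by `t` letters `false` and a letter
`true`. -/
def first : List Bool → ℕ → ℕ
  | [], t => t
  | true :: _, _ => 0
  | false :: w, t => first w t + 1

/-- The weight of the word `w`, followed by `t` letters `false` and a letter `true`: a letter `true`
has the weight `β j`, where `j` is the number of letters `false` up to the next `true`. -/
def wordWeight (β : ℕ → ℂ) : List Bool → ℕ → ℂ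
  | [], _ => 1
  | true :: w, t => β (first w t) * wordWeight β w t
  | false :: w, t => wordWeight β w t

/-- The sum of the weights of the words of length `l`, preceded by a letter `true` and `a` letters
`false`. -/
def openSum (β : ℕ → ℂ) (t l a : ℕ) : ℂ :=
  ∑ w : Fin l → Bool, β (a + first (List.ofFn w) t) * wordWeight β (List.ofFn w) t

/-- The sum of the weights of the cyclic words which begin with `i` letters `false`, followed by `l`
arbitrary letters. -/
def cyclicSum (β : ℕ → ℂ) (l i : ℕ) : ℂ :=
  ∑ w : Fin l → Bool, wordWeight β (List.ofFn w) (i + first (List.ofFn w) 0)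

theorem sum_words_succ {l : ℕ} (f : (Fin (l + 1) → Bool) → ℂ) :
    ∑ w, f w = ∑ w : Fin l → Bool, f (Fin.cons true w) + ∑ w : Fin l → Bool, f (Fin.cons false w) := by
  rw [← (Fin.consEquiv fun _ => Bool).sum_comp, Fintype.sum_prod_type, Fintype.sum_bool]
  rfl

/-- Split by the first letter: `false` lengthens the current gap, while `true` closes it with weight
β a and opens a new one. -/
theorem openSum_succ (β : ℕ → ℂ) (t l a : ℕ) :
    openSum β t (l + 1) a = openSum β t l (a + 1) + β a * openSum β t l 0 := by
  unfold openSum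
  rw [sum_words_succ, Finset.mul_sum, add_comm]
  simp [first, wordWeight, add_comm, add_left_comm]

/-- Iterated splitting: k counts the letters `false` before the first `true`, and the isolated term
is the word without `true`. -/
theorem openSum_eq (β : ℕ → ℂ) (t l a : ℕ) :
    openSum β t l a =
      β (a + l + t) + ∑ k ∈ Finset.range l, β (a + k) * openSum β t (l - 1 - k) 0 := by
  induction l generalizing a with
  | zero => simp [openSum, first, wordWeight]
  | succ l ih =>
    rw [openSum_succ, ih, Finset.sum_range_succ', add_assoc]
    congr 1
    · congr 1; ring
    · congr 1
      refine Finset.sum_congr rfl fun k _ => ?_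
      rw [show a + 1 + k = a + (k + 1) by ring, show l + 1 - 1 - (k + 1) = l - 1 - k by omega]

theorem cyclicSum_zero (β : ℕ → ℂ) (i : ℕ) : cyclicSum β 0 i = 1 := by
  simp [cyclicSum, wordWeight]

/-- If the first free letter is `false`, it joins the initial run. If it is `true`, the cyclic word
is cut there, and the initial run of i letters `false` moves to its end. -/
theorem cyclicSum_succ (β : ℕ → ℂ) (l i : ℕ) :
    cyclicSum β (l + 1) i = cyclicSum β l (i + 1) + openSum β i l 0 := by
  unfold openSum cyclicSum
  rw [sum_words_succ, add_comm]
  simp [first, wordWeight, add_comm, add_left_comm]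

/-- The renewal equation for the sums over cyclic words. -/
theorem cyclicSum_sub_one (β : ℕ → ℂ) (n i : ℕ) :
    cyclicSum β (n + 1) i - 1 =
      (n + 1) * β (n + i) + ∑ k ∈ Finset.range n, β k * (cyclicSum β (n - k) i - 1) := by
  induction n generalizing i with
  | zero =>
    rw [cyclicSum_succ, cyclicSum_zero, openSum_eq]
    simp
  | succ n ih =>
    rw [cyclicSum_succ, add_sub_right_comm, ih, openSum_eq, Finset.sum_range_succ,
      Finset.sum_range_succ, add_add_add_comm]
    -- The term k = n comes from the open sum alone; for k < n each term splits by the first-letter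
    -- recursion into one from the induction hypothesis and one from the open sum.
    have h1 : cyclicSum β (n + 1 - n) i - 1 = openSum β i (n + 1 - 1 - n) 0 := by
      rw [show n + 1 - n = 0 + 1 by omega, cyclicSum_succ, cyclicSum_zero]; simp
    have h2 : ∀ k ∈ Finset.range n, β k * (cyclicSum β (n + 1 - k) i - 1) =
        β k * (cyclicSum β (n - k) (i + 1) - 1) + β (0 + k) * openSum β i (n + 1 - 1 - k) 0 := by
      intro k hk
      have := Finset.mem_range.1 hk
      rw [show n + 1 - k = n - k + 1 by omega, cyclicSum_succ, zero_add,
        show n + 1 - 1 - k = n - k by omega]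
      ring
    rw [Finset.sum_congr rfl h2, Finset.sum_add_distrib, h1]
    push_cast
    rw [show n + (i + 1) = n + 1 + i by ring, show 0 + (n + 1) + i = n + 1 + i by ring, zero_add]
    ring

theorem first_eq {x : ℕ → Bool} {n t : ℕ} (t' : ℕ) (ht : t < n) (h0 : ∀ k < t, x k = false)
    (h1 : x t = true) : first (List.ofFn fun i : Fin n => x i) t' = t := by
  induction n generalizing x t with
  | zero => omega
  | succ n ih =>
    rw [List.ofFn_succ]
    cases t with
    | zero => simp only [Fin.val_zero, h1]; rfl
    | succ t =>
      simp only [Fin.val_zero, h0 0 (by omega)]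
      rw [first, Nat.add_right_cancel_iff]
      exact ih (x := fun k => x (k + 1)) (by omega) (fun k hk => h0 _ (by omega)) h1

theorem first_spec {x : ℕ → Bool} {n t : ℕ} (h0 : ∀ k < t, x (n + k) = false)
    (h1 : x (n + t) = true) :
    (∀ k < first (List.ofFn fun i : Fin n => x i) t, x k = false) ∧
      x (first (List.ofFn fun i : Fin n => x i) t) = true := by
  induction n generalizing x with
  | zero => simpa [first] using And.intro h0 h1
  | succ n ih =>
    rw [List.ofFn_succ]
    cases h : x 0
    · simp only [Fin.val_zero, h, first]
      obtain ⟨a, b⟩ := ih (x := fun k => x (k + 1))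
        (fun k hk => by rw [← h0 k hk]; congr 1; ring) (by rw [← h1]; congr 1; ring)
      refine ⟨fun k hk => ?_, b⟩
      cases k with
      | zero => exact h
      | succ k => exact a k (by simpa using hk)
    · simp only [Fin.val_zero, h, first]
      exact ⟨by simp, trivial⟩

/-- The product along an orbit depends on the future of the point only up to the next `true`; `h0`
and `h1` record where it occurs after the first n letters. -/
theorem prod_eq_wordWeight {β : ℕ → ℂ} {γ : (ℕ → Bool) → ℂ}
    (hf : ∀ x : ℕ → Bool, x 0 = false → γ x = 1)
    (ht : ∀ (x : ℕ → Bool) (j : ℕ), x 0 = true → (∀ k < j, x (k + 1) = false) →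
      x (j + 1) = true → γ x = β j)
    {x : ℕ → Bool} {n t : ℕ} (h0 : ∀ k < t, x (n + k) = false) (h1 : x (n + t) = true) :
    ∏ k ∈ Finset.range n, γ (fun j => x (k + j)) =
      wordWeight β (List.ofFn fun i : Fin n => x i) t := by
  induction n generalizing x with
  | zero => simp [wordWeight]
  | succ n ih =>
    have h0' : ∀ k < t, x (n + k + 1) = false := fun k hk => by rw [← h0 k hk]; congr 1; ring
    have h1' : x (n + t + 1) = true := by rw [← h1]; congr 1; ring
    have ih' := ih (x := fun k => x (k + 1)) h0' h1'
    obtain ⟨a, b⟩ := first_spec (x := fun k => x (k + 1)) h0' h1'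
    rw [Finset.prod_range_succ', List.ofFn_succ]
    have e : ∀ k, (fun j => x (k + 1 + j)) = fun j => x (k + j + 1) := fun k => by
      ext j; congr 1; ring
    simp only [e, ih', zero_add, Fin.val_zero, Fin.val_succ]
    cases h : x 0
    · simp only [wordWeight, hf x h, mul_one]
    · simp only [wordWeight]
      rw [ht x _ h a b, mul_comm]

/-! ### The weight -/

/-- A smooth bump which is `1` on `[7/8, 9/8]` and vanishes outside `(1/2, 3/2)`. -/
noncomputable def bump : ContDiffBump (1 : ℝ) := ⟨1 / 8, 1 / 2, by norm_num, by norm_num⟩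

theorem bump_eq_one {t : ℝ} (h1 : 1 ≤ t) (h2 : t ≤ 9 / 8) : bump t = 1 := by
  refine bump.one_of_mem_closedBall ?_
  rw [mem_closedBall, Real.dist_eq, abs_le]
  change _ ≤ _ ∧ _ ≤ (1 / 8 : ℝ)
  change -(1 / 8 : ℝ) ≤ _ ∧ _
  constructor <;> linarith

theorem bump_eq_zero_of_le {t : ℝ} (h : t ≤ 1 / 2) : bump t = 0 := by
  refine bump.zero_of_le_dist ?_
  rw [Real.dist_eq]
  change (1 / 2 : ℝ) ≤ _
  rw [abs_of_nonpos] <;> linarith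

theorem bump_eq_zero_of_ge {t : ℝ} (h : 3 / 2 ≤ t) : bump t = 0 := by
  refine bump.zero_of_le_dist ?_
  rw [Real.dist_eq]
  change (1 / 2 : ℝ) ≤ _
  rw [abs_of_nonneg] <;> linarith

/-- The weight as a function of the first coordinate. -/
noncomputable def weightFun (β : ℕ → ℂ) (u : ℝ) : ℂ :=
  ((1 - step u : ℝ) : ℂ) + ∑' j, β j * (bump (9 ^ (j + 1) * (u - 1)) : ℂ)

theorem exists_iteratedFDeriv_bump_le (k : ℕ) :
    ∃ C : ℝ, 0 ≤ C ∧ ∀ (c y : ℝ), 0 ≤ c →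
      ‖iteratedFDeriv ℝ k (fun y : ℝ => ((bump (c * y) : ℝ) : ℂ)) y‖ ≤ c ^ k * C := by
  have hs : ContDiff ℝ k fun t : ℝ => ((bump t : ℝ) : ℂ) :=
    Complex.ofRealCLM.contDiff.comp bump.contDiff
  have hc : HasCompactSupport fun t : ℝ => ((bump t : ℝ) : ℂ) :=
    bump.hasCompactSupport.comp_left (g := fun t : ℝ => (t : ℂ)) (by simp)
  obtain ⟨C, hC⟩ := (hc.iteratedFDeriv (𝕜 := ℝ) k).exists_bound_of_continuous
    (hs.continuous_iteratedFDeriv le_rfl)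
  refine ⟨C, (norm_nonneg _).trans (hC 0), fun c y hc0 => ?_⟩
  rw [norm_iteratedFDeriv_eq_norm_iteratedDeriv,
    iteratedDeriv_comp_const_smul (f := fun t : ℝ => ((bump t : ℝ) : ℂ)) hs, norm_smul, norm_pow,
    Real.norm_of_nonneg hc0, ← norm_iteratedFDeriv_eq_norm_iteratedDeriv]
  gcongr
  exact hC _

/-- The k-th derivative of the j-th bump is of order 9^((j+1)k) by the chain rule. The decay of β,
used with r = 9^k, makes the series of k-th derivatives converge normally for each k. -/
theorem contDiff_weightFun {β : ℕ → ℂ} (hβ : ∀ r : ℝ, 0 < r → Summable fun j => ‖β j‖ * r ^ j) :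
    ContDiff ℝ ∞ (weightFun β) := by
  have h1 : ContDiff ℝ ∞ fun u : ℝ => ((1 - step u : ℝ) : ℂ) :=
    Complex.ofRealCLM.contDiff.comp (contDiff_const.sub contDiff_step)
  choose C hC0 hC using exists_iteratedFDeriv_bump_le
  have h2 : ContDiff ℝ ∞ fun y : ℝ => ∑' j, β j * (bump (9 ^ (j + 1) * y) : ℂ) := by
    have hb : ∀ j : ℕ, ContDiff ℝ ∞ fun y : ℝ => ((bump (9 ^ (j + 1) * y) : ℝ) : ℂ) := fun j =>
      Complex.ofRealCLM.contDiff.comp (bump.contDiff.comp (by fun_prop))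
    refine contDiff_tsum (N := ⊤) (v := fun k j => ‖β j‖ * (((9 : ℝ) ^ (j + 1)) ^ k * C k))
      (fun j => contDiff_const.mul (hb j)) (fun k _ => ?_) (fun k j y _ => ?_)
    · refine ((hβ (9 ^ k) (by positivity)).mul_right (9 ^ k * C k)).congr fun j => ?_
      rw [← pow_mul, ← pow_mul]
      ring
    · have := iteratedFDeriv_const_smul_apply (𝕜 := ℝ) (i := k) (x := y) (a := β j)
        ((hb j).of_le (mod_cast le_top)).contDiffAt
      simp only [Pi.smul_def, smul_eq_mul] at this
      rw [this]
      rw [norm_smul]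
      gcongr
      exact hC k _ y (by positivity)
  exact h1.add (h2.comp (contDiff_id.sub contDiff_const))

theorem weightFun_expand_of_false (β : ℕ → ℂ) {x : ℕ → Bool} (hx : x 0 = false) :
    weightFun β (expand x) = 1 := by
  have h1 := expand_eq x
  have h2 := expand_le fun k => x (k + 1)
  rw [hx, digit_false, zero_add] at h1
  have h3 : expand x ≤ 1 / 8 := by linarith
  have h4 : ∀ j : ℕ, bump (9 ^ (j + 1) * (expand x - 1)) = 0 := fun j =>
    bump_eq_zero_of_le ((mul_nonpos_of_nonneg_of_nonpos (by positivity) (by linarith)).trans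
      (by norm_num))
  rw [weightFun, step_of_le (by linarith)]
  simp [h4]

theorem expand_eq_of_forall_false {x : ℕ → Bool} {j : ℕ} (h : ∀ k < j, x k = false) :
    expand x = expand (fun k => x (k + j)) / 9 ^ j := by
  induction j generalizing x with
  | zero => simp
  | succ j ih =>
    rw [expand_eq, h 0 (by omega), digit_false, zero_add,
      ih (x := fun k => x (k + 1)) (fun k hk => h _ (by omega)), div_div, ← pow_succ]
    rfl

/-- Here `expand x` is 1 + y / 9^(j+1) with y in [1, 9/8]. The argument of the i-th bump is 9^(i-j)
y, which lies on the plateau for i = j and outside the support otherwise. -/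
theorem weightFun_expand_of_true (β : ℕ → ℂ) {x : ℕ → Bool} {j : ℕ} (hx : x 0 = true)
    (h0 : ∀ k < j, x (k + 1) = false) (h1 : x (j + 1) = true) :
    weightFun β (expand x) = β j := by
  have e1 := expand_eq x
  rw [hx, digit_true, expand_eq_of_forall_false h0] at e1
  set y : ℕ → Bool := fun k => x (k + j + 1) with hy
  have hy0 : y 0 = true := by simpa [hy] using h1
  have e2 := expand_eq y
  have e3 := expand_le fun k => y (k + 1)
  have e4 := expand_nonneg fun k => y (k + 1)
  rw [hy0, digit_true] at e2
  have e5 : expand x - 1 = expand y / 9 ^ (j + 1) := by rw [e1, pow_succ, ← div_div]; simp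
  have l1 : 1 ≤ expand y := by linarith
  have l2 : expand y ≤ 9 / 8 := by linarith
  have l3 : 1 ≤ expand x := by
    have : 0 ≤ expand y / 9 ^ (j + 1) := div_nonneg (by linarith) (by positivity)
    linarith
  rw [weightFun, step_of_ge (by linarith), tsum_eq_single j, e5]
  · rw [mul_div_cancel₀ _ (by positivity), bump_eq_one l1 l2]
    simp
  · intro i hi
    have : bump (9 ^ (i + 1) * (expand x - 1)) = 0 := by
      rw [e5]
      rcases lt_or_gt_of_ne hi with h | h
      · obtain ⟨m, rfl⟩ := Nat.exists_eq_add_of_lt h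
        apply bump_eq_zero_of_le
        have : (9 : ℝ) ^ (i + 1) * (expand y / 9 ^ (i + m + 1 + 1)) = expand y / 9 ^ (m + 1) := by
          rw [show i + m + 1 + 1 = (i + 1) + (m + 1) by ring, pow_add 9 (i + 1)]
          field_simp
        rw [this, div_le_iff₀ (by positivity)]
        have : (1 : ℝ) ≤ 9 ^ m := one_le_pow₀ (by norm_num)
        rw [pow_succ]
        linarith
      · obtain ⟨m, rfl⟩ := Nat.exists_eq_add_of_lt h
        apply bump_eq_zero_of_ge
        have : (9 : ℝ) ^ (j + m + 1 + 1) * (expand y / 9 ^ (j + 1)) = expand y * 9 ^ (m + 1) := by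
          rw [show j + m + 1 + 1 = (j + 1) + (m + 1) by ring, pow_add 9 (j + 1)]
          field_simp
        rw [this]
        have : (1 : ℝ) ≤ 9 ^ m := one_le_pow₀ (by norm_num)
        rw [pow_succ]
        nlinarith
    rw [this]; simp

/-! ### Periodic points -/

/-- The periodic sequence which repeats the word `w`. -/
def periodize {n : ℕ} (w : Fin (n + 1) → Bool) (k : ℤ) : Bool :=
  w ⟨(k % ((n + 1 : ℕ) : ℤ)).toNat, by
    have := Int.emod_lt_of_pos k (b := ((n + 1 : ℕ) : ℤ)) (by omega)
    omega⟩

theorem periodize_add {n : ℕ} (w : Fin (n + 1) → Bool) (k : ℤ) :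
    periodize w (k + (n + 1 : ℕ)) = periodize w k := by
  simp only [periodize, Int.add_emod_right]

theorem periodize_natCast {n : ℕ} (w : Fin (n + 1) → Bool) (i : Fin (n + 1)) :
    periodize w ((i : ℕ) : ℤ) = w i := by
  unfold periodize
  congr 1
  ext
  have := i.2
  simp only
  rw [Int.emod_eq_of_lt (by omega) (by omega)]
  simp

theorem periodize_injective (n : ℕ) :
    Function.Injective (periodize : (Fin (n + 1) → Bool) → ℤ → Bool) := by
  intro w w' h
  ext1 i
  rw [← periodize_natCast w, h, periodize_natCast]

theorem eq_periodize {n : ℕ} {s : ℤ → Bool} (h : ∀ k, s (k + (n + 1 : ℕ)) = s k) :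
    s = periodize fun i : Fin (n + 1) => s i := by
  have h' : Function.Periodic s ((n + 1 : ℕ) : ℤ) := h
  ext1 k
  have h1 : ((k % ((n + 1 : ℕ) : ℤ)).toNat : ℤ) = k % ((n + 1 : ℕ) : ℤ) :=
    Int.toNat_of_nonneg (Int.emod_nonneg _ (by omega))
  simp only [periodize, h1]
  conv_lhs => rw [← Int.emod_add_mul_ediv k ((n + 1 : ℕ) : ℤ), mul_comm]
  exact h'.int_mul _ _

theorem periodicPointsIn_horseshoe (n : ℕ) :
    periodicPointsIn fwd horseshoe (n + 1) =
      range fun w : Fin (n + 1) → Bool => code (periodize w) := by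
  ext p
  constructor
  · rintro ⟨⟨s, rfl⟩, h⟩
    rw [iterate_fwd_code] at h
    have h := congrFun (code_injective h)
    exact ⟨_, congrArg code (eq_periodize h).symm⟩
  · rintro ⟨w, rfl⟩
    refine ⟨⟨_, rfl⟩, ?_⟩
    rw [iterate_fwd_code]
    simp only [periodize_add]

theorem finite_periodicPointsIn_horseshoe (n : ℕ) (hn : 1 ≤ n) :
    (periodicPointsIn fwd horseshoe n).Finite := by
  obtain ⟨n, rfl⟩ := Nat.exists_eq_add_of_le' hn
  rw [periodicPointsIn_horseshoe]
  exact finite_range _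

theorem prod_weight_periodize (β : ℕ → ℂ) {n : ℕ} (w : Fin (n + 1) → Bool) :
    ∏ k ∈ Finset.range (n + 1), weightFun β (fwd^[k] (code (periodize w)) 0) =
      wordWeight β (List.ofFn w) (0 + first (List.ofFn w) 0) := by
  set x : ℕ → Bool := fun j => periodize w j with hx
  have hxp : ∀ k, x (n + 1 + k) = x k := fun k => by
    simp only [hx]
    rw [← periodize_add w (k : ℤ)]
    congr 1
    push_cast
    ring
  have hw : List.ofFn w = List.ofFn fun i : Fin (n + 1) => x i := by
    congr 1; ext1 i; exact (periodize_natCast w i).symm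
  have he : ∀ k, fwd^[k] (code (periodize w)) 0 = expand fun j => x (k + j) := fun k => by
    rw [iterate_fwd_code, code_zero]
    congr 1; ext j; simp only [hx]; congr 1; push_cast; ring
  simp only [he, hw, zero_add]
  by_cases h : ∃ i, i < n + 1 ∧ x i = true
  · have hf := Nat.find_spec h
    set t := Nat.find h with ht
    have h0 : ∀ k < t, x k = false := fun k hk => by
      have := Nat.find_min h hk
      simpa [show k < n + 1 by omega] using this
    rw [first_eq 0 hf.1 h0 hf.2]
    exact prod_eq_wordWeight (γ := fun x => weightFun β (expand x))
      (fun x hx => weightFun_expand_of_false β hx)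
      (fun x j => weightFun_expand_of_true β)
      (fun k hk => by rw [hxp]; exact h0 k hk) (by rw [hxp]; exact hf.2)
  -- In the word without `true`, `first` returns the length instead of the position of a `true`;
  -- this is harmless, since no letter then carries a factor β.
  · push Not at h
    have hz : ∀ m ≤ n + 1, ∀ t, wordWeight β (List.ofFn fun i : Fin m => false) t = 1 := by
      intro m _ t
      induction m with
      | zero => simp [wordWeight]
      | succ m ih => rw [List.ofFn_succ]; exact ih (by omega)
    have hx0 : (fun i : Fin (n + 1) => x i) = fun _ => false := by
      ext1 i; simpa using h i i.2
    rw [hx0, hz _ le_rfl]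
    refine Finset.prod_eq_one fun k hk => weightFun_expand_of_false β ?_
    simpa using h k (Finset.mem_range.1 hk)

theorem flatTrace_horseshoe (β : ℕ → ℂ) (n : ℕ) :
    flatTrace (m := 2) fwd horseshoe (fun p => weightFun β (p 0)) (n + 1) =
      cyclicSum β (n + 1) 0 / ((((9 : ℝ) ^ (n + 1) - 1) * (1 - (1 / 9) ^ (n + 1)) : ℝ) : ℂ) := by
  unfold flatTrace
  rw [periodicPointsIn_horseshoe, finsum_mem_range (g := fun w : Fin (n + 1) → Bool => code (periodize w))
      (code_injective.comp (periodize_injective n)),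
    finsum_eq_sum_of_fintype, cyclicSum, Finset.sum_div]
  refine Finset.sum_congr rfl fun w _ => ?_
  rw [absDetOneSubDeriv_iterate_fwd, prod_weight_periodize]

end Horseshoe

namespace Horseshoe

/-! ### The determinant of the horseshoe -/

/-- The exponential series of the sums over cyclic words, in terms of the logarithm of `F`. -/
theorem cyclicSum_eq_of_log {β f l : ℕ → ℂ} (hf0 : f 0 = 1) (hfβ : ∀ j, f (j + 1) = -β j)
    (h : ∀ n : ℕ, ∑ i ∈ Finset.range (n + 1), f i * ((n - i + 1 : ℕ) * l (n - i + 1)) =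
      (n + 1 : ℕ) * f (n + 1)) (n : ℕ) :
    (n : ℂ) * l n = -(cyclicSum β n 0 - 1) := by
  induction n using Nat.strong_induction_on with
  | _ n ih =>
    cases n with
    | zero => simp [cyclicSum_zero]
    | succ n =>
      have h1 := h n
      rw [Finset.sum_range_succ', hf0, one_mul, Nat.sub_zero] at h1
      have h2 : ∑ i ∈ Finset.range n, f (i + 1) * ((n - (i + 1) + 1 : ℕ) * l (n - (i + 1) + 1)) =
          ∑ i ∈ Finset.range n, β i * (cyclicSum β (n - i) 0 - 1) := by
        refine Finset.sum_congr rfl fun i hi => ?_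
        have := Finset.mem_range.1 hi
        rw [show n - (i + 1) + 1 = n - i by omega, ih _ (by omega), hfβ]
        ring
      rw [h2, hfβ] at h1
      rw [cyclicSum_sub_one, eq_sub_of_add_eq' h1]
      push_cast
      simp
      ring

-- Near 0 the function L = log F satisfies F L' = F'. Comparing Taylor coefficients gives the
-- renewal recursion of the cyclic sums with i = 0, so the n-th coefficient of L is (1 - Z_n)/n. The
-- remaining ones sum to -log(1 - w).
open Nat in
theorem hasSum_cyclicSum {F : ℂ → ℂ} (hF : Differentiable ℂ F) (hF0 : F 0 = 1) {β : ℕ → ℂ}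
    (hβ : ∀ j, β j = -(((j + 1) ! : ℂ)⁻¹ * iteratedDeriv (j + 1) F 0)) :
    ∃ ρ : ℝ, 0 < ρ ∧ ∀ w : ℂ, ‖w‖ < ρ → ∃ S : ℂ,
      HasSum (fun n : ℕ => cyclicSum β (n + 1) 0 / ((n + 1 : ℕ) : ℂ) * w ^ (n + 1)) S ∧
      Complex.exp (-S) = (1 - w) * F w := by
  obtain ⟨ρ, hρ, hball⟩ := Metric.mem_nhds_iff.1 (hF.continuous.continuousAt.preimage_mem_nhds
    (Complex.isOpen_slitPlane.mem_nhds (x := F 0) (by rw [hF0]; simp)))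
  have hL : DifferentiableOn ℂ (fun w => Complex.log (F w)) (ball 0 ρ) :=
    hF.differentiableOn.clog hball
  set L : ℂ → ℂ := fun w => Complex.log (F w) with hLdef
  set l : ℕ → ℂ := fun n => (n ! : ℂ)⁻¹ * iteratedDeriv n L 0 with hl
  set f : ℕ → ℂ := fun n => (n ! : ℂ)⁻¹ * iteratedDeriv n F 0 with hf
  have hLan : AnalyticAt ℂ L 0 := hL.analyticAt (ball_mem_nhds _ hρ)
  have hODE : F * deriv L =ᶠ[𝓝 0] deriv F := by
    filter_upwards [ball_mem_nhds (0 : ℂ) hρ] with w hw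
    have h1 : HasDerivAt L (deriv F w / F w) w := (hF w).hasDerivAt.clog (hball hw)
    rw [Pi.mul_apply, h1.deriv, mul_div_cancel₀ _ (Complex.slitPlane_ne_zero (hball hw))]
  have hrec : ∀ n : ℕ, ∑ i ∈ Finset.range (n + 1), f i * ((n - i + 1 : ℕ) * l (n - i + 1)) =
      (n + 1 : ℕ) * f (n + 1) := by
    intro n
    have h1 := iteratedDeriv_mul (n := n) (x := (0 : ℂ)) (f := F) (g := deriv L)
      hF.contDiff.contDiffAt hLan.deriv.contDiffAt
    rw [hODE.iteratedDeriv_eq, ← iteratedDeriv_succ'] at h1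
    have h2 : ((n + 1 : ℕ) : ℂ) * f (n + 1) = (n ! : ℂ)⁻¹ * iteratedDeriv (n + 1) F 0 := by
      simp only [hf, factorial_succ]
      push_cast
      have : (n : ℂ) + 1 ≠ 0 := by exact_mod_cast n.succ_ne_zero
      field_simp
    rw [h2, h1, Finset.mul_sum]
    refine Finset.sum_congr rfl fun i hi => ?_
    have hi : i ≤ n := by simpa [Nat.lt_succ_iff] using hi
    rw [← iteratedDeriv_succ']
    simp only [hf, hl, factorial_succ]
    have h3 : (n.choose i : ℂ) * i ! * (n - i)! = n ! := by
      exact_mod_cast Nat.choose_mul_factorial_mul_factorial hi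
    rw [← h3]
    have h4 : (n.choose i : ℂ) ≠ 0 := by exact_mod_cast (Nat.choose_pos hi).ne'
    have h5 : ((i ! : ℕ) : ℂ) ≠ 0 := by exact_mod_cast i.factorial_ne_zero
    have h6 : (((n - i)! : ℕ) : ℂ) ≠ 0 := by exact_mod_cast (n - i).factorial_ne_zero
    have h7 : ((n - i + 1 : ℕ) : ℂ) ≠ 0 := by exact_mod_cast (n - i).succ_ne_zero
    push_cast at h7 ⊢
    field_simp
  have hZ : ∀ n : ℕ, (n : ℂ) * l n = -(cyclicSum β n 0 - 1) :=
    cyclicSum_eq_of_log (f := f) (by simp [hf, hF0]) (fun j => by rw [hβ]; simp [hf]) hrec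
  refine ⟨min ρ 1, by positivity, fun w hw => ?_⟩
  have hw1 : ‖w‖ < 1 := hw.trans_le (min_le_right _ _)
  have hw2 : w ∈ ball (0 : ℂ) ρ := by simpa using hw.trans_le (min_le_left _ _)
  have s1 : HasSum (fun n : ℕ => l (n + 1) * w ^ (n + 1)) (L w) := by
    have := Complex.hasSum_taylorSeries_on_ball hL hw2
    rw [hasSum_nat_add_iff' 1 |>.symm] at this
    simp only [Finset.range_one, Finset.sum_singleton, iteratedDeriv_zero, hLdef, hF0,
      Complex.log_one, smul_zero, sub_zero] at this
    refine this.congr_fun fun n => ?_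
    simp only [hl, smul_eq_mul]
    ring
  have s2 : HasSum (fun n : ℕ => w ^ (n + 1) / ((n + 1 : ℕ) : ℂ)) (-Complex.log (1 - w)) := by
    have := Complex.hasSum_taylorSeries_neg_log hw1
    rw [hasSum_nat_add_iff' 1 |>.symm] at this
    simpa using this
  refine ⟨-Complex.log (1 - w) - L w, (s2.sub s1).congr_fun fun n => ?_, ?_⟩
  · have h1 := hZ (n + 1)
    have h7 : ((n + 1 : ℕ) : ℂ) ≠ 0 := by exact_mod_cast n.succ_ne_zero
    have h2 : cyclicSum β (n + 1) 0 = 1 - (n + 1 : ℕ) * l (n + 1) := by rw [h1]; ring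
    rw [h2]
    field_simp
  · rw [neg_sub, sub_neg_eq_add, Complex.exp_add,
      Complex.exp_log (Complex.slitPlane_ne_zero (hball hw2)), Complex.exp_log, mul_comm]
    rw [sub_ne_zero]
    rintro rfl
    simp at hw1

/-! ### Normally convergent products of scaled powers -/

/-- An infinite product of entire functions which converges normally on compact sets is entire. -/
theorem entire_tprod {f : ℕ → ℂ → ℂ} (hd : ∀ k, Differentiable ℂ (f k))
    (hb : ∀ R : ℝ, ∃ u : ℕ → ℝ, Summable u ∧ ∀ k z, ‖z‖ ≤ R → ‖f k z - 1‖ ≤ u k) :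
    Differentiable ℂ (fun z => ∏' k, f k z) ∧ (∀ z, HasProd (fun k => f k z) (∏' k, f k z)) ∧
      ∀ z, (∀ k, f k z ≠ 0) → ∏' k, f k z ≠ 0 := by
  have hR : ∀ R : ℝ, HasProdLocallyUniformlyOn f (fun z => ∏' k, f k z) (ball 0 R) := by
    intro R
    obtain ⟨u, hu, hle⟩ := hb R
    have := Summable.hasProdLocallyUniformlyOn_nat_one_add (f := fun k z => f k z - 1)
      (K := ball (0 : ℂ) R) isOpen_ball hu
      (.of_forall fun k z hz => hle k z (by simpa using (mem_ball.1 hz).le))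
      (fun k => ((hd k).continuous.sub continuous_const).continuousOn)
    simpa using this
  refine ⟨fun z => ?_, fun z => ?_, fun z hz => ?_⟩
  · exact ((hR (‖z‖ + 1)).differentiableOn (.of_forall fun s =>
      (Differentiable.fun_finsetProd fun k _ => hd k).differentiableOn) isOpen_ball).differentiableAt
        (isOpen_ball.mem_nhds (by simp))
  · exact (hR (‖z‖ + 1)).hasProd (by simp)
  · obtain ⟨u, hu, hle⟩ := hb ‖z‖
    have := tprod_one_add_ne_zero_of_summable (f := fun k => f k z - 1) (by simpa using hz)
      (.of_nonneg_of_le (fun _ => norm_nonneg _) (fun k => hle k z le_rfl) hu)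
    simpa using this

theorem summable_natCast_div_pow : Summable fun k : ℕ => (k : ℝ) / 9 ^ k := by
  have := (hasSum_coe_mul_geometric_of_norm_lt_one (r := (1 / 9 : ℝ)) (by norm_num)).summable
  refine this.congr fun k => ?_
  rw [one_div, inv_pow]; rfl

theorem exists_norm_sub_one_le {D : ℂ → ℂ} (hD : Differentiable ℂ D) (hD0 : D 0 = 1) (R : ℝ) :
    ∃ M : ℝ, 0 ≤ M ∧ ∀ z, ‖z‖ ≤ R → ‖D z - 1‖ ≤ M * ‖z‖ := by
  obtain ⟨M, hM⟩ := (isCompact_closedBall (0 : ℂ) R).exists_bound_of_continuousOn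
    (f := deriv D) (hD.contDiff.continuous_deriv le_rfl).continuousOn
  refine ⟨max M 0, le_max_right _ _, fun z hz => ?_⟩
  have := (convex_closedBall (0 : ℂ) R).norm_image_sub_le_of_norm_deriv_le (f := D)
    (fun x _ => hD x) (C := max M 0) (fun x hx => (hM x hx).trans (le_max_left _ _))
    (mem_closedBall_self ((norm_nonneg z).trans hz)) (by simpa using hz : z ∈ closedBall (0 : ℂ) R)
  simpa [hD0] using this

/-- Since D(z / 9^k) = 1 + O(9^(-k)) uniformly on discs, its k-th power differs from 1 by O(k /
9^k), which is summable. -/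
theorem exists_summable_pow_sub_one {D : ℂ → ℂ} (hD : Differentiable ℂ D) (hD0 : D 0 = 1) (R : ℝ) :
    ∃ u : ℕ → ℝ, Summable u ∧ ∀ (k : ℕ) (z : ℂ), ‖z‖ ≤ R → ‖D (z / 9 ^ k) ^ k - 1‖ ≤ u k := by
  obtain ⟨M, hM0, hM⟩ := exists_norm_sub_one_le hD hD0 R
  set C : ℝ := M * |R| with hC
  have hC0 : 0 ≤ C := by positivity
  have h9 : ∀ k : ℕ, (k : ℝ) / 9 ^ k ≤ 1 := fun k => by
    rw [div_le_one (by positivity)]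
    exact_mod_cast (Nat.lt_pow_self (by norm_num : 1 < 9)).le
  refine ⟨fun k => C * (k / 9 ^ k) * Real.exp C, (summable_natCast_div_pow.mul_left C).mul_right _,
    fun k z hz => ?_⟩
  have h1 : ‖z / 9 ^ k‖ = ‖z‖ / 9 ^ k := by simp
  have h2 : ‖D (z / 9 ^ k) - 1‖ ≤ C / 9 ^ k := by
    have h3 : ‖z / 9 ^ k‖ ≤ ‖z‖ := by
      rw [h1]; exact div_le_self (norm_nonneg _) (one_le_pow₀ (by norm_num))
    refine (hM _ (h3.trans hz)).trans ?_
    rw [h1, hC, mul_div_assoc]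
    gcongr
    exact hz.trans (le_abs_self R)
  have h3 := Finset.norm_prod_one_add_sub_one_le (Finset.range k) fun _ => D (z / 9 ^ k) - 1
  simp only [add_sub_cancel, Finset.prod_const, Finset.card_range, Finset.sum_const,
    nsmul_eq_mul] at h3
  refine h3.trans ?_
  set t : ℝ := C * (k / 9 ^ k) with ht
  have h4 : (k : ℝ) * ‖D (z / 9 ^ k) - 1‖ ≤ t := by
    rw [ht, show C * ((k : ℝ) / 9 ^ k) = k * (C / 9 ^ k) by ring]
    gcongr
  have h5 : t ≤ C := mul_le_of_le_one_right hC0 (h9 k)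
  have h6 : 0 ≤ t := by positivity
  have h7 : 1 - t ≤ Real.exp (-t) := by linarith [Real.add_one_le_exp (-t)]
  calc Real.exp (k * ‖D (z / 9 ^ k) - 1‖) - 1 ≤ Real.exp t - 1 := by gcongr
    _ ≤ t * Real.exp t := by
      have := mul_le_mul_of_nonneg_right h7 (Real.exp_pos t).le
      rw [← Real.exp_add] at this
      simp at this
      linarith
    _ ≤ t * Real.exp C := by gcongr

/-- The infinite product of the powers `D (z / 9 ^ k) ^ k`. -/
noncomputable def powProd (D : ℂ → ℂ) (z : ℂ) : ℂ := ∏' k : ℕ, D (z / 9 ^ k) ^ k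

theorem differentiable_factor {D : ℂ → ℂ} (hD : Differentiable ℂ D) (k : ℕ) :
    Differentiable ℂ fun z => D (z / 9 ^ k) ^ k :=
  (hD.comp (differentiable_id.div_const _)).pow k

theorem differentiable_powProd {D : ℂ → ℂ} (hD : Differentiable ℂ D) (hD0 : D 0 = 1) :
    Differentiable ℂ (powProd D) :=
  (entire_tprod (differentiable_factor hD) (exists_summable_pow_sub_one hD hD0)).1

theorem hasProd_powProd {D : ℂ → ℂ} (hD : Differentiable ℂ D) (hD0 : D 0 = 1) (z : ℂ) :
    HasProd (fun k : ℕ => D (z / 9 ^ k) ^ k) (powProd D z) :=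
  (entire_tprod (differentiable_factor hD) (exists_summable_pow_sub_one hD hD0)).2.1 z

/-- With x = 9^(-(n+1)) the determinant is (1 - x)^2 / x, and x / (1 - x)^2 = ∑ k x^k. The index k
becomes the exponent in `powProd`. -/
theorem hasSum_inv_det (n : ℕ) :
    HasSum (fun k : ℕ => (k : ℂ) * ((1 / 9) ^ (n + 1)) ^ k)
      ((((9 : ℝ) ^ (n + 1) - 1) * (1 - (1 / 9) ^ (n + 1)) : ℝ) : ℂ)⁻¹ := by
  have hn : ‖((1 / 9 : ℂ)) ^ (n + 1)‖ < 1 := by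
    rw [norm_pow]
    exact pow_lt_one₀ (norm_nonneg _) (by norm_num) (by omega)
  convert! hasSum_coe_mul_geometric_of_norm_lt_one hn using 1
  have h1 : (9 : ℂ) ^ (n + 1) - 1 ≠ 0 := by
    rw [sub_ne_zero]
    exact_mod_cast (Nat.one_lt_pow (by omega) (by norm_num : 1 < 9)).ne'
  have h2 : (9 : ℂ) ^ (n + 1) ≠ 0 := pow_ne_zero _ (by norm_num)
  push_cast
  rw [one_div, inv_pow]
  generalize (9 : ℂ) ^ (n + 1) = x at h1 h2
  have h3 : 1 - x⁻¹ ≠ 0 := by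
    intro h
    apply h1
    field_simp at h
    simpa using h
  have h4 : 1 - x⁻¹ = (x - 1) / x := by field_simp
  rw [h4]
  field_simp

/-- For every entire function `F` with `F 0 = 1`, the product of the powers
`((1 - z / 9 ^ k) F (z / 9 ^ k)) ^ k` is a dynamical determinant. -/
theorem isSmoothDynamicalDeterminant_powProd {F : ℂ → ℂ} (hF : Differentiable ℂ F) (hF0 : F 0 = 1) :
    IsSmoothDynamicalDeterminant (powProd fun w => (1 - w) * F w) := by
  set D : ℂ → ℂ := fun w => (1 - w) * F w with hD
  have hDd : Differentiable ℂ D := by fun_prop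
  have hD0 : D 0 = 1 := by simp [hD, hF0]
  set β : ℕ → ℂ := fun j => -(((j + 1).factorial : ℂ)⁻¹ * iteratedDeriv (j + 1) F 0) with hβ
  have hsum : ∀ r : ℝ, 0 < r → Summable fun j => ‖β j‖ * r ^ j := by
    intro r hr
    have h1 := (Complex.hasSum_taylorSeries_of_entire hF 0 (r : ℂ)).summable.norm
    have h2 := ((summable_nat_add_iff 1).2 h1).mul_left r⁻¹
    refine h2.congr fun j => ?_
    simp only [hβ, norm_neg, norm_mul, smul_eq_mul, sub_zero, norm_pow, Complex.norm_real,
      Real.norm_of_nonneg hr.le]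
    rw [pow_succ]
    field_simp
  have hsmooth : ContDiff ℝ ∞ fun p : Plane => weightFun β (p 0) :=
    (contDiff_weightFun hsum).comp (by fun_prop)
  refine ⟨2, Plane, inferInstance, inferInstance, inferInstance, inferInstance, inferInstance,
    horseshoeMap, horseshoe, fun p => weightFun β (p 0), isHyperbolicBasicSet_horseshoe,
    hsmooth.contMDiff, finite_periodicPointsIn_horseshoe, differentiable_powProd hDd hD0, ?_⟩
  obtain ⟨ρ, hρ, hS⟩ := hasSum_cyclicSum hF hF0 (β := β) fun j => rfl
  filter_upwards [ball_mem_nhds (0 : ℂ) hρ] with z hz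
  have hz : ‖z‖ < ρ := by simpa using hz
  set a : ℕ → ℂ := fun n => cyclicSum β (n + 1) 0 / ((n + 1 : ℕ) : ℂ) with ha
  have hzk : ∀ k : ℕ, ‖z / 9 ^ k‖ < ρ := fun k => by
    refine lt_of_le_of_lt ?_ hz
    rw [norm_div, norm_pow]
    exact div_le_self (norm_nonneg _) (one_le_pow₀ (by norm_num))
  choose S hS1 hS2 using fun k => hS _ (hzk k)
  -- Summed over k first, this double series gives the exponent of the dynamical determinant; summed
  -- over n first, it gives k S(k), where exp(-S(k)) = D(z / 9^k). Absolute convergence identifies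
  -- the two.
  set f : ℕ × ℕ → ℂ := fun p => (a p.1 * z ^ (p.1 + 1)) * ((p.2 : ℂ) * ((1 / 9) ^ (p.1 + 1)) ^ p.2)
    with hf
  have hfs : Summable f := by
    have h1 : Summable fun n : ℕ => ‖a n * z ^ (n + 1)‖ := by
      obtain ⟨S, hS, -⟩ := hS z hz
      exact hS.summable.norm
    refine Summable.of_norm_bounded (h1.mul_of_nonneg summable_natCast_div_pow
      (fun _ => norm_nonneg _) (fun _ => by positivity)) fun p => ?_
    rw [hf, norm_mul]
    gcongr
    rw [norm_mul, ← pow_mul, norm_pow, Complex.norm_natCast, div_eq_mul_inv (p.2 : ℝ), ← inv_pow,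
      show ‖(1 / 9 : ℂ)‖ = 9⁻¹ by norm_num]
    exact mul_le_mul_of_nonneg_left (pow_le_pow_of_le_one (by norm_num) (by norm_num)
      (Nat.le_mul_of_pos_left _ (by omega))) (by positivity)
  obtain ⟨s, hs⟩ := hfs
  have h1 := hs.prod_fiberwise (g := fun n => (1 / ((n + 1 : ℕ) : ℂ)) *
    flatTrace (m := 2) fwd horseshoe (fun p => weightFun β (p 0)) (n + 1) * z ^ (n + 1)) fun n => by
      convert! (hasSum_inv_det n).mul_left (a n * z ^ (n + 1)) using 1
      rw [flatTrace_horseshoe, ha]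
      simp only [div_eq_mul_inv]
      ring
  have h2 := ((Equiv.prodComm ℕ ℕ).hasSum_iff.2 hs).prod_fiberwise (g := fun k : ℕ => (k : ℂ) * S k)
    fun k => by
      refine ((hS1 k).mul_left (k : ℂ)).congr_fun fun n => ?_
      simp only [hf, Function.comp_apply, Equiv.prodComm_apply, Prod.swap]
      have : ((1 / 9 : ℂ) ^ (n + 1)) ^ k = ((9 ^ k) ^ (n + 1))⁻¹ := by
        rw [one_div, inv_pow, inv_pow, ← pow_mul, ← pow_mul, mul_comm]
      rw [this, div_pow, div_eq_mul_inv]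
      ring
  refine ⟨s, h1, ?_⟩
  have h3 := h2.neg.cexp
  refine (hasProd_powProd hDd hD0 z).unique (h3.congr_fun fun k => ?_)
  rw [Function.comp_apply, ← mul_neg, Complex.exp_nat_mul, hS2]

end Horseshoe

namespace Horseshoe

/-! ### Orders of entire functions -/

theorem tendsto_const_div_log_add (a α : ℝ) :
    Tendsto (fun r : ℝ => ((a / Real.log r + α : ℝ) : EReal)) atTop (𝓝 (α : EReal)) := by
  refine (continuous_coe_real_ereal.tendsto α).comp ?_
  simpa using (Real.tendsto_log_atTop.const_div_atTop a).add_const α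

theorem entireOrder_le {f : ℂ → ℂ} {α C : ℝ} (hα : 0 ≤ α)
    (hf : ∀ r : ℝ, 1 ≤ r → ∀ z, ‖z‖ ≤ r → ‖f z‖ ≤ Real.exp (C * r ^ α)) :
    entireOrder f ≤ α := by
  have hf : ∀ r : ℝ, 1 ≤ r → ∀ z, ‖z‖ ≤ r → ‖f z‖ ≤ Real.exp (|C| * r ^ α) := fun r hr z hz =>
    (hf r hr z hz).trans (Real.exp_le_exp.2
      (mul_le_mul_of_nonneg_right (le_abs_self C) (Real.rpow_nonneg (by linarith) _)))
  rw [← (tendsto_const_div_log_add (Real.posLog |C|) α).limsup_eq]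
  refine limsup_le_limsup ?_
  filter_upwards [eventually_gt_atTop 1] with r hr
  have hr0 : 0 < r := by linarith
  have hlog : 0 < Real.log r := Real.log_pos hr
  have hne : Nonempty (closedBall (0 : ℂ) r) := ⟨⟨0, by simp [hr0.le]⟩⟩
  have h0 : 0 ≤ |C| * r ^ α := mul_nonneg (abs_nonneg C) (Real.rpow_nonneg hr0.le _)
  have h1 : ⨆ z : closedBall (0 : ℂ) r, ‖f z‖ ≤ Real.exp (|C| * r ^ α) :=
    ciSup_le fun z => hf r hr.le z (mem_closedBall_zero_iff.1 z.2)
  have h2 : Real.posLog (⨆ z : closedBall (0 : ℂ) r, ‖f z‖) ≤ |C| * r ^ α := by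
    refine (Real.posLog_le_posLog (Real.iSup_nonneg fun _ => norm_nonneg _) h1).trans ?_
    rw [Real.posLog_apply, Real.log_exp, max_eq_right h0]
  have h3 : Real.posLog (Real.posLog (⨆ z : closedBall (0 : ℂ) r, ‖f z‖)) ≤
      Real.posLog |C| + α * Real.log r := by
    refine (Real.posLog_le_posLog Real.posLog_nonneg h2).trans (Real.posLog_mul.trans ?_)
    gcongr
    rw [Real.posLog_apply, Real.log_rpow hr0, max_eq_right (by positivity)]
  rw [EReal.coe_le_coe_iff, div_le_iff₀ hlog, add_mul, div_mul_cancel₀ _ hlog.ne']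
  exact h3

theorem le_entireOrder {f : ℂ → ℂ} (hfc : Continuous f) {α c : ℝ} (hc : 0 < c)
    (hf : ∀ᶠ r : ℝ in atTop, ∃ z, ‖z‖ ≤ r ∧ Real.exp (c * r ^ α) ≤ ‖f z‖) :
    (α : EReal) ≤ entireOrder f := by
  rw [← (tendsto_const_div_log_add (Real.log c) α).limsup_eq]
  refine limsup_le_limsup ?_
  filter_upwards [eventually_gt_atTop 1, hf] with r hr hz
  obtain ⟨z, hz, hfz⟩ := hz
  have hr0 : 0 < r := by linarith
  have hlog : 0 < Real.log r := Real.log_pos hr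
  have hp : 0 < c * r ^ α := mul_pos hc (Real.rpow_pos_of_pos hr0 _)
  have hbdd : BddAbove (range fun z : closedBall (0 : ℂ) r => ‖f z‖) := by
    have : CompactSpace (closedBall (0 : ℂ) r) :=
      isCompact_iff_compactSpace.1 (isCompact_closedBall _ _)
    exact (isCompact_range (hfc.norm.comp continuous_subtype_val)).bddAbove
  have h1 : Real.exp (c * r ^ α) ≤ ⨆ z : closedBall (0 : ℂ) r, ‖f z‖ :=
    hfz.trans (le_ciSup hbdd ⟨z, by simpa using hz⟩)
  have h2 : c * r ^ α ≤ Real.posLog (⨆ z : closedBall (0 : ℂ) r, ‖f z‖) := by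
    refine le_trans ?_ (Real.posLog_le_posLog (Real.exp_pos _).le h1)
    rw [Real.posLog_apply, Real.log_exp]
    exact le_max_right _ _
  have h3 : Real.log c + α * Real.log r ≤
      Real.posLog (Real.posLog (⨆ z : closedBall (0 : ℂ) r, ‖f z‖)) := by
    refine le_trans ?_ (Real.posLog_le_posLog hp.le h2)
    rw [Real.posLog_apply, Real.log_mul hc.ne' (Real.rpow_pos_of_pos hr0 _).ne',
      Real.log_rpow hr0]
    exact le_max_right _ _
  rw [EReal.coe_le_coe_iff, le_div_iff₀ hlog, add_mul, div_mul_cancel₀ _ hlog.ne']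
  exact h3

/-! ### Growth of the product -/

theorem summable_natCast_mul_rpow {β : ℝ} (hβ : 0 < β) :
    Summable fun k : ℕ => (k : ℝ) * ((9 : ℝ) ^ (-β)) ^ k := by
  refine (hasSum_coe_mul_geometric_of_norm_lt_one ?_).summable
  rw [Real.norm_of_nonneg (by positivity)]
  exact Real.rpow_lt_one_of_one_lt_of_neg (by norm_num) (by linarith)

/-- Two exponents are needed: log |D| may vanish more slowly than |w|^α at 0. The smaller exponent β
makes ∑ k 9^(-βk) available for summing over the factors, the larger one α carries the growth in r.
-/
theorem norm_powProd_le {D : ℂ → ℂ} (hD : Differentiable ℂ D) (hD0 : D 0 = 1) {C α β : ℝ}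
    (hC : 0 ≤ C) (hβ : 0 < β) (hβα : β ≤ α)
    (h : ∀ w, ‖D w‖ ≤ Real.exp (C * (‖w‖ ^ β + ‖w‖ ^ α))) :
    ∃ C' : ℝ, ∀ r : ℝ, 1 ≤ r → ∀ z, ‖z‖ ≤ r → ‖powProd D z‖ ≤ Real.exp (C' * r ^ α) := by
  have hs := summable_natCast_mul_rpow hβ
  set A := ∑' k : ℕ, (k : ℝ) * ((9 : ℝ) ^ (-β)) ^ k with hA
  refine ⟨2 * C * A, fun r hr z hz => ?_⟩
  have hr0 : 0 < r := by linarith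
  have hfac : ∀ k : ℕ, ‖D (z / 9 ^ k) ^ k‖ ≤
      Real.exp (2 * C * r ^ α * (k * ((9 : ℝ) ^ (-β)) ^ k)) := by
    intro k
    have h9 : (0 : ℝ) < 9 ^ k := by positivity
    have hn : ‖z / 9 ^ k‖ ≤ r * (9 ^ k)⁻¹ := by
      rw [norm_div, norm_pow, div_eq_mul_inv]
      norm_num
      gcongr
    have hexp : ∀ γ : ℝ, β ≤ γ → γ ≤ α → ‖z / 9 ^ k‖ ^ γ ≤ r ^ α * ((9 : ℝ) ^ (-β)) ^ k := by
      intro γ h1 h2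
      calc ‖z / 9 ^ k‖ ^ γ ≤ (r * (9 ^ k)⁻¹) ^ γ := by
            exact Real.rpow_le_rpow (norm_nonneg _) hn (by linarith)
        _ = r ^ γ * ((9 ^ k)⁻¹) ^ γ := Real.mul_rpow hr0.le (by positivity)
        _ ≤ r ^ α * ((9 ^ k)⁻¹) ^ β := by
            refine mul_le_mul (Real.rpow_le_rpow_of_exponent_le hr h2)
              (Real.rpow_le_rpow_of_exponent_ge (by positivity)
                (inv_le_one_of_one_le₀ (one_le_pow₀ (by norm_num))) h1)
              (by positivity) (by positivity)
        _ = r ^ α * ((9 : ℝ) ^ (-β)) ^ k := by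
            rw [Real.inv_rpow h9.le, Real.rpow_neg (by norm_num), inv_pow, ← Real.rpow_natCast,
              ← Real.rpow_natCast, ← Real.rpow_mul (by norm_num), ← Real.rpow_mul (by norm_num),
              mul_comm β]
    rw [norm_pow]
    refine (pow_le_pow_left₀ (norm_nonneg _) (h _) k).trans ?_
    rw [← Real.exp_nat_mul]
    refine Real.exp_le_exp.2 ?_
    have := add_le_add (hexp β le_rfl hβα) (hexp α hβα le_rfl)
    calc (k : ℝ) * (C * (‖z / 9 ^ k‖ ^ β + ‖z / 9 ^ k‖ ^ α))
        ≤ k * (C * (r ^ α * ((9 : ℝ) ^ (-β)) ^ k + r ^ α * ((9 : ℝ) ^ (-β)) ^ k)) := by gcongr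
      _ = _ := by ring
  refine le_of_tendsto' ((hasProd_powProd hD hD0 z).norm.tendsto_prod_nat) fun n => ?_
  refine (Finset.prod_le_prod (fun _ _ => norm_nonneg _) fun k _ => hfac k).trans ?_
  rw [← Real.exp_sum, ← Finset.mul_sum]
  refine Real.exp_le_exp.2 ?_
  have := hs.sum_le_tsum (Finset.range n) (fun k _ => by positivity)
  calc 2 * C * r ^ α * ∑ k ∈ Finset.range n, (k : ℝ) * ((9 : ℝ) ^ (-β)) ^ k
      ≤ 2 * C * r ^ α * A := by gcongr
    _ = _ := by ring

/-- All factors have modulus at least 1 on the negative axis, so the product dominates its factor k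
= 1; the factor k = 0 is trivial. -/
theorem le_norm_powProd {D : ℂ → ℂ} (hD : Differentiable ℂ D) (hD0 : D 0 = 1)
    (h : ∀ s : ℝ, 0 ≤ s → 1 ≤ ‖D (-s)‖) {r : ℝ} (hr : 0 ≤ r) :
    ‖D (-(r / 9 : ℝ))‖ ≤ ‖powProd D (-r)‖ := by
  have hfac : ∀ k : ℕ, 1 ≤ ‖D (-(r : ℂ) / 9 ^ k) ^ k‖ := by
    intro k
    rw [norm_pow]
    refine one_le_pow₀ ?_
    have := h (r / 9 ^ k) (by positivity)
    push_cast at this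
    rwa [neg_div]
  refine ge_of_tendsto ((hasProd_powProd hD hD0 (-r)).norm.tendsto_prod_nat) ?_
  filter_upwards [eventually_ge_atTop 2] with n hn
  rw [← Finset.mul_prod_erase _ _ (Finset.mem_range.2 (by omega : 1 < n))]
  have h1 : 1 ≤ ∏ k ∈ (Finset.range n).erase 1, ‖D (-(r : ℂ) / 9 ^ k) ^ k‖ :=
    Finset.one_le_prod fun k _ => hfac k
  refine le_trans (le_of_eq ?_) (le_mul_of_one_le_right (norm_nonneg _) h1)
  rw [pow_one, pow_one]
  congr 2
  push_cast
  ring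

end Horseshoe

namespace Horseshoe

/-! ### Genus -/

section Genus

variable {E : ℂ → ℂ}

theorem factor_ne_zero (hE : ∀ w, E w ≠ 0) {z : ℂ} (hz : ∀ k : ℕ, z ≠ 9 ^ (k + 1)) (k : ℕ) :
    ((1 - z / 9 ^ k) * E (z / 9 ^ k)) ^ k ≠ 0 := by
  cases k with
  | zero => simp
  | succ k =>
    refine pow_ne_zero _ (mul_ne_zero ?_ (hE _))
    rw [sub_ne_zero, ne_comm, ne_eq, div_eq_one_iff_eq (pow_ne_zero _ (by norm_num))]
    exact hz k

theorem powProd_ne_zero (hE : Differentiable ℂ E) (hE0 : E 0 = 1) (hne : ∀ w, E w ≠ 0) {z : ℂ}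
    (hz : ∀ k : ℕ, z ≠ 9 ^ (k + 1)) : powProd (fun w => (1 - w) * E w) z ≠ 0 := by
  have hD : Differentiable ℂ fun w => (1 - w) * E w := by fun_prop
  exact (entire_tprod (differentiable_factor hD)
    (exists_summable_pow_sub_one hD (by simp [hE0]))).2.2 z (factor_ne_zero hne hz)

/-- Only the factor k = n + 1 vanishes at 9^(n+1), to order n + 1; the product of the others is
entire and non-zero there. -/
theorem analyticOrderNatAt_powProd (hE : Differentiable ℂ E) (hE0 : E 0 = 1) (hne : ∀ w, E w ≠ 0)
    (n : ℕ) : analyticOrderNatAt (powProd fun w => (1 - w) * E w) (9 ^ (n + 1)) = n + 1 := by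
  set D : ℂ → ℂ := fun w => (1 - w) * E w with hDdef
  have hD : Differentiable ℂ D := by fun_prop
  have hD0 : D 0 = 1 := by simp [hDdef, hE0]
  have h9 : ∀ k : ℕ, (9 : ℂ) ^ k ≠ 0 := fun k => pow_ne_zero _ (by norm_num)
  set f : ℕ → ℂ → ℂ := fun k z => if k = n + 1 then 1 else D (z / 9 ^ k) ^ k with hf
  have hfd : ∀ k, Differentiable ℂ (f k) := by
    intro k
    by_cases h : k = n + 1
    · simp only [hf, h, if_true]; exact differentiable_const 1
    · simp only [hf, h, if_false]; exact differentiable_factor hD k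
  obtain ⟨hGd, hGp, hGne⟩ := entire_tprod hfd fun R => by
    obtain ⟨u, hu, hle⟩ := exists_summable_pow_sub_one hD hD0 R
    refine ⟨u, hu, fun k z hz => ?_⟩
    by_cases h : k = n + 1
    · simpa [hf, h] using (norm_nonneg _).trans (hle (n + 1) z hz)
    · simpa [hf, h] using hle k z hz
  have hfac : ∀ z, powProd D z = D (z / 9 ^ (n + 1)) ^ (n + 1) * ∏' k, f k z := by
    intro z
    refine Multipliable.tprod_eq_mul_tprod_ite' (n + 1) ((hGp z).multipliable.congr fun k => ?_)
    simp [hf, Function.update_apply]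
  have hne0 : ∏' k, f k (9 ^ (n + 1)) ≠ 0 := by
    refine hGne _ fun k => ?_
    by_cases h : k = n + 1
    · simp [hf, h]
    · simp only [hf, h, if_false]
      cases k with
      | zero => simp
      | succ k =>
        refine pow_ne_zero _ (mul_ne_zero ?_ (hne _))
        rw [sub_ne_zero, ne_comm, ne_eq, div_eq_one_iff_eq (h9 _)]
        intro h'
        apply h
        exact (Nat.pow_right_injective (le_refl 2 |>.trans (by norm_num : 2 ≤ 9))
          (by exact_mod_cast h')).symm
  have han : AnalyticAt ℂ (powProd D) (9 ^ (n + 1)) := (differentiable_powProd hD hD0).analyticAt _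
  have hord : analyticOrderAt (powProd D) (9 ^ (n + 1)) = ((n + 1 : ℕ) : ℕ∞) := by
    rw [han.analyticOrderAt_eq_natCast]
    refine ⟨fun z => (-((9 : ℂ) ^ (n + 1))⁻¹) ^ (n + 1) * E (z / 9 ^ (n + 1)) ^ (n + 1) *
      ∏' k, f k z, Differentiable.analyticAt (by fun_prop) _, ?_, .of_forall fun z => ?_⟩
    · exact mul_ne_zero (mul_ne_zero (pow_ne_zero _ (neg_ne_zero.2 (inv_ne_zero (h9 _))))
        (pow_ne_zero _ (hne _))) hne0
    · rw [hfac, smul_eq_mul, ← mul_assoc, ← mul_pow, ← mul_pow]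
      congr 2
      simp only [hDdef]
      have := h9 (n + 1)
      field_simp
      ring
  rw [analyticOrderNatAt, hord]
  rfl

/-- The zeros of the determinant, in increasing order. -/
noncomputable def zeroEquiv (hE : Differentiable ℂ E) (hE0 : E 0 = 1) (hne : ∀ w, E w ≠ 0) :
    ℕ ≃ nonzeroZeros (powProd fun w => (1 - w) * E w) :=
  Equiv.ofBijective (fun n => ⟨9 ^ (n + 1), pow_ne_zero _ (by norm_num), by
    by_contra h
    have han := (differentiable_powProd (D := fun w => (1 - w) * E w) (by fun_prop)
      (by simp [hE0])).analyticAt (9 ^ (n + 1))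
    have h1 := analyticOrderNatAt_powProd hE hE0 hne n
    rw [analyticOrderNatAt, han.analyticOrderAt_eq_zero.2 h] at h1
    simp at h1⟩) (by
  constructor
  · intro a b h
    have h : (9 : ℂ) ^ (a + 1) = 9 ^ (b + 1) := congrArg Subtype.val h
    have : a + 1 = b + 1 := Nat.pow_right_injective (by norm_num : 2 ≤ 9) (by exact_mod_cast h)
    omega
  · rintro ⟨z, hz0, hz⟩
    by_contra h
    refine powProd_ne_zero hE hE0 hne (fun k hk => h ⟨k, Subtype.ext hk.symm⟩) hz)

@[simp] theorem coe_zeroEquiv (hE : Differentiable ℂ E) (hE0 : E 0 = 1) (hne : ∀ w, E w ≠ 0)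
    (n : ℕ) : (zeroEquiv hE hE0 hne n : ℂ) = 9 ^ (n + 1) := rfl

/-- The zeros 9^k with multiplicity k satisfy ∑ k / 9^k < ∞, so p = 0 and the primary factors are 1
- z/w. The exponential factors multiply to exp(∑ k H(z / 9^k)), so the degree of Q is the genus. -/
theorem hasGenus_powProd {H : ℂ → ℂ} {Q : Polynomial ℂ} (hH : Differentiable ℂ H) (hH0 : H 0 = 0)
    (hQ : ∀ z, HasSum (fun k : ℕ => (k : ℂ) * H (z / 9 ^ k)) (Q.eval z))
    (hord : entireOrder (powProd fun w => (1 - w) * Complex.exp (H w)) ≠ ⊤) :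
    HasGenus (powProd fun w => (1 - w) * Complex.exp (H w)) Q.natDegree := by
  have hE : Differentiable ℂ fun w => Complex.exp (H w) := by fun_prop
  have hE0 : (fun w => Complex.exp (H w)) 0 = 1 := by simp [hH0]
  have hne : ∀ w, (fun w => Complex.exp (H w)) w ≠ 0 := fun w => Complex.exp_ne_zero _
  have hD : Differentiable ℂ fun w => (1 - w) * Complex.exp (H w) := by fun_prop
  have hD0 : (fun w => (1 - w) * Complex.exp (H w)) 0 = 1 := by simp [hH0]
  have h0 : powProd (fun w => (1 - w) * Complex.exp (H w)) 0 ≠ 0 :=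
    powProd_ne_zero hE hE0 hne fun k => (pow_ne_zero _ (by norm_num)).symm
  refine .inr ⟨hord, ⟨0, h0⟩, 0, Q, ⟨?_, fun _ _ => Nat.zero_le _⟩, fun z => ?_, by simp⟩
  · change Summable _
    rw [← (zeroEquiv hE hE0 hne).summable_iff]
    refine ((summable_nat_add_iff 1).2 summable_natCast_div_pow).congr fun n => ?_
    rw [Function.comp_apply, coe_zeroEquiv,
      analyticOrderNatAt_powProd (E := fun w => Complex.exp (H w)) hE hE0 hne]
    simp
  · have hP := hasProd_powProd (D := fun w => 1 - w) (by fun_prop) (by simp) z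
    refine ⟨powProd (fun w => 1 - w) z, ?_, ?_⟩
    · rw [← (zeroEquiv hE hE0 hne).hasProd_iff]
      -- The zeros are indexed from 9^1, whereas the product starts at k = 0, where the factor is 1.
      refine ((Nat.succ_injective.hasProd_iff fun k hk => ?_).2 hP).congr_fun fun n => ?_
      · cases k with
        | zero => simp
        | succ k => exact absurd ⟨k, rfl⟩ hk
      · rw [Function.comp_apply, coe_zeroEquiv,
          analyticOrderNatAt_powProd (E := fun w => Complex.exp (H w)) hE hE0 hne]
        simp [primaryFactor]
    · have hz : analyticOrderNatAt (powProd fun w => (1 - w) * Complex.exp (H w)) 0 = 0 := by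
        rw [analyticOrderNatAt,
          ((differentiable_powProd hD hD0).analyticAt 0).analyticOrderAt_eq_zero.2 h0]
        rfl
      rw [hz, pow_zero, one_mul]
      refine (hasProd_powProd hD hD0 z).unique (((hQ z).cexp.mul hP).congr_fun fun k => ?_)
      rw [Function.comp_apply, Complex.exp_nat_mul, mul_pow, mul_comm]

end Genus

/-! ### Determinants of every genus -/

theorem norm_one_sub_le_exp (w : ℂ) : ‖1 - w‖ ≤ Real.exp ‖w‖ :=
  calc ‖1 - w‖ ≤ ‖(1 : ℂ)‖ + ‖w‖ := norm_sub_le _ _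
    _ ≤ Real.exp ‖w‖ := by rw [norm_one, add_comm]; exact Real.add_one_le_exp _

theorem entireOrder_powProd_exp_ne_top {H : ℂ → ℂ} (hH : Differentiable ℂ H) (hH0 : H 0 = 0) {γ : ℕ}
    (hγ : 1 ≤ γ) (h : ∀ w, ‖H w‖ ≤ ‖w‖ ^ γ) :
    entireOrder (powProd fun w => (1 - w) * Complex.exp (H w)) ≠ ⊤ := by
  have hγ' : (1 : ℝ) ≤ γ := by exact_mod_cast hγ
  obtain ⟨C, hC⟩ := norm_powProd_le (D := fun w => (1 - w) * Complex.exp (H w)) (by fun_prop)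
    (by simp [hH0]) zero_le_one zero_lt_one hγ' fun w => by
      rw [norm_mul, one_mul, Real.exp_add, Real.rpow_one, Real.rpow_natCast]
      refine mul_le_mul (norm_one_sub_le_exp w) ?_ (norm_nonneg _) (Real.exp_pos _).le
      rw [Complex.norm_exp]
      exact Real.exp_le_exp.2 ((Complex.re_le_norm _).trans (h w))
  exact ((entireOrder_le (by linarith) hC).trans_lt (EReal.coe_lt_top _)).ne

theorem exists_genus_zero : ∃ d : ℂ → ℂ, IsSmoothDynamicalDeterminant d ∧ HasGenus d 0 := by
  refine ⟨_, isSmoothDynamicalDeterminant_powProd (F := fun w => Complex.exp ((fun _ => 0) w))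
    (by fun_prop) (by simp), ?_⟩
  exact hasGenus_powProd (H := fun _ => 0) (Q := 0) (by fun_prop) rfl (fun z => by simp [hasSum_zero])
    (entireOrder_powProd_exp_ne_top (by fun_prop) rfl le_rfl fun w => by simp)

theorem exists_genus_succ (n : ℕ) :
    ∃ d : ℂ → ℂ, IsSmoothDynamicalDeterminant d ∧ HasGenus d ((n + 1 : ℕ) : ℕ∞) := by
  -- The leading coefficient of Q is ∑ k r^k = r / (1 - r)^2; it is non-zero, so Q has degree
  -- exactly n + 1.
  set r : ℂ := (9 ^ (n + 1))⁻¹ with hr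
  have hr9 : (9 : ℂ) ^ (n + 1) ≠ 0 := pow_ne_zero _ (by norm_num)
  have hr1 : ‖r‖ < 1 := by
    rw [hr, norm_inv, norm_pow]
    exact inv_lt_one_of_one_lt₀ (one_lt_pow₀ (by norm_num) (by omega))
  have hr2 : r / (1 - r) ^ 2 ≠ 0 := by
    refine div_ne_zero (inv_ne_zero hr9) (pow_ne_zero _ (sub_ne_zero.2 ?_))
    rintro h
    rw [← h, norm_one] at hr1
    exact lt_irrefl _ hr1
  refine ⟨_, isSmoothDynamicalDeterminant_powProd
    (F := fun w => Complex.exp ((fun w => w ^ (n + 1)) w)) (by fun_prop) (by simp), ?_⟩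
  have := hasGenus_powProd (H := fun w => w ^ (n + 1))
    (Q := Polynomial.C (r / (1 - r) ^ 2) * Polynomial.X ^ (n + 1)) (by fun_prop) (by simp)
    (fun z => by
      rw [Polynomial.eval_mul, Polynomial.eval_C, Polynomial.eval_pow, Polynomial.eval_X]
      refine ((hasSum_coe_mul_geometric_of_norm_lt_one hr1).mul_right (z ^ (n + 1))).congr_fun
        fun k => ?_
      rw [hr, inv_pow, ← pow_mul, mul_comm (n + 1), pow_mul, div_pow]
      ring)
    (entireOrder_powProd_exp_ne_top (by fun_prop) (by simp) (by omega : 1 ≤ n + 1)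
      fun w => by rw [norm_pow])
  rwa [Polynomial.natDegree_C_mul_X_pow _ _ hr2] at this

theorem exists_genus_top : ∃ d : ℂ → ℂ, IsSmoothDynamicalDeterminant d ∧ HasGenus d ⊤ := by
  -- The constant -1 normalises F(0) = 1, and the sign of w puts the doubly exponential growth on
  -- the negative axis, where 1 - w has modulus at least 1.
  set F : ℂ → ℂ := fun w => Complex.exp (Complex.exp (-w) - 1) with hF
  have hFd : Differentiable ℂ F := by fun_prop
  have hF0 : F 0 = 1 := by simp [hF]
  refine ⟨_, isSmoothDynamicalDeterminant_powProd hFd hF0, .inl ⟨?_, rfl⟩⟩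
  set D : ℂ → ℂ := fun w => (1 - w) * F w with hDdef
  have hD : Differentiable ℂ D := by fun_prop
  have hD0 : D 0 = 1 := by simp [hDdef, hF0]
  have hDs : ∀ s : ℝ, 0 ≤ s → Real.exp (Real.exp s - 1) ≤ ‖D (-s)‖ := by
    intro s hs
    have h1 : D (-s) = (((1 + s) * Real.exp (Real.exp s - 1) : ℝ) : ℂ) := by
      simp [hDdef, hF]
    rw [h1, Complex.norm_real, Real.norm_of_nonneg (by positivity)]
    exact le_mul_of_one_le_left (Real.exp_pos _).le (by linarith)
  have hD1 : ∀ s : ℝ, 0 ≤ s → 1 ≤ ‖D (-s)‖ := fun s hs =>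
    (Real.one_le_exp (by linarith [Real.one_le_exp hs])).trans (hDs s hs)
  rw [EReal.eq_top_iff_forall_lt]
  intro y
  refine lt_of_lt_of_le (EReal.coe_lt_coe_iff.2 (lt_max_of_lt_left (lt_add_one y)) :
    (y : EReal) < (max (y + 1) 0 : ℝ)) ?_
  -- A non-negative exponent gives r^α ≥ 1; together with exp(r/9) ≥ 2 r^α this absorbs the -1 in
  -- the exponent of F.
  set α : ℝ := max (y + 1) 0 with hα
  refine le_entireOrder (differentiable_powProd hD hD0).continuous one_pos ?_
  filter_upwards [eventually_ge_atTop 1,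
    (tendsto_exp_mul_div_rpow_atTop α (1 / 9) (by norm_num)).eventually_ge_atTop 2] with r hr h2
  refine ⟨-r, by simp [abs_of_nonneg (zero_le_one.trans hr)], ?_⟩
  have hr0 : 0 ≤ r := by linarith
  refine le_trans (Real.exp_le_exp.2 ?_) ((hDs (r / 9) (by positivity)).trans ?_)
  · rw [le_div_iff₀ (by positivity)] at h2
    have h3 : 1 ≤ r ^ α := Real.one_le_rpow hr (le_max_right _ _)
    rw [show r / 9 = 1 / 9 * r by ring]
    linarith
  · exact le_norm_powProd hD hD0 hD1 hr0

end Horseshoe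

namespace Horseshoe

/-! ### A determinant of prescribed order -/

open Nat in
/-- The coefficients `(n!)^{-1/δ}` of an entire function of order `δ`. -/
noncomputable def orderCoeff (δ : ℝ) (n : ℕ) : ℝ := ((n ! : ℝ) ^ δ⁻¹)⁻¹

open Nat in
theorem orderCoeff_pos (δ : ℝ) (n : ℕ) : 0 < orderCoeff δ n :=
  inv_pos.2 (Real.rpow_pos_of_pos (by exact_mod_cast n.factorial_pos) _)

@[simp] theorem orderCoeff_zero (δ : ℝ) : orderCoeff δ 0 = 1 := by simp [orderCoeff]

-- The terms are the (1/δ)-th powers of those of the exponential series at s^δ; the upper and the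
-- lower bound both come from this comparison.
open Nat in
theorem orderCoeff_mul_pow {δ : ℝ} (hδ : 0 < δ) {s : ℝ} (hs : 0 ≤ s) (n : ℕ) :
    orderCoeff δ n * s ^ n = ((s ^ δ) ^ n / n !) ^ δ⁻¹ := by
  rw [Real.div_rpow (by positivity) (by positivity), orderCoeff, ← Real.rpow_natCast (s ^ δ),
    ← Real.rpow_mul hs, ← Real.rpow_mul hs, mul_right_comm, mul_inv_cancel₀ hδ.ne', one_mul,
    Real.rpow_natCast, div_eq_mul_inv, mul_comm]

/-- Bounding the term at 2s by a single exponential leaves the factor 2^(-n), which makes the bound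
summable. -/
theorem orderCoeff_mul_pow_le {δ : ℝ} (hδ : 0 < δ) {s : ℝ} (hs : 0 ≤ s) (n : ℕ) :
    orderCoeff δ n * s ^ n ≤ (1 / 2) ^ n * Real.exp ((2 * s) ^ δ / δ) := by
  have h := orderCoeff_mul_pow hδ (s := 2 * s) (by positivity) n
  have h1 : orderCoeff δ n * s ^ n = (1 / 2) ^ n * (orderCoeff δ n * (2 * s) ^ n) := by
    rw [mul_pow, one_div, inv_pow]
    field_simp
  rw [h1, h, div_eq_mul_inv ((2 * s) ^ δ), Real.exp_mul]
  gcongr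
  exact Real.pow_div_factorial_le_exp _ (by positivity) n

theorem summable_orderCoeff {δ : ℝ} (hδ : 0 < δ) {s : ℝ} (hs : 0 ≤ s) :
    Summable fun n => orderCoeff δ n * s ^ n :=
  .of_nonneg_of_le (fun n => mul_nonneg (orderCoeff_pos δ n).le (by positivity))
    (orderCoeff_mul_pow_le hδ hs) (summable_geometric_two.mul_right _)

/-- The power series `∑ s^n / (n!)^{1/δ}`. -/
noncomputable def orderSeries (δ s : ℝ) : ℝ := ∑' n, orderCoeff δ n * s ^ n

theorem orderSeries_le {δ : ℝ} (hδ : 0 < δ) {s : ℝ} (hs : 0 ≤ s) :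
    orderSeries δ s ≤ 2 * Real.exp ((2 * s) ^ δ / δ) := by
  exact hasSum_le (orderCoeff_mul_pow_le hδ hs) (summable_orderCoeff hδ hs).hasSum
    (hasSum_geometric_two.mul_right _)

theorem one_le_orderSeries {δ : ℝ} (hδ : 0 < δ) {s : ℝ} (hs : 0 ≤ s) : 1 ≤ orderSeries δ s := by
  have := (summable_orderCoeff hδ hs).le_tsum 0
    fun n _ => mul_nonneg (orderCoeff_pos δ n).le (by positivity)
  simpa [orderSeries] using this

theorem orderSeries_le_of_le_one {δ : ℝ} (hδ : 0 < δ) {s : ℝ} (hs : 0 ≤ s) (hs1 : s ≤ 1) :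
    orderSeries δ s ≤ 1 + orderSeries δ 1 * s := by
  have h1 := summable_orderCoeff hδ hs
  have h2 := summable_orderCoeff hδ zero_le_one
  rw [orderSeries, h1.tsum_eq_zero_add, orderSeries, h2.tsum_eq_zero_add]
  have h3 : ∑' n, orderCoeff δ (n + 1) * s ^ (n + 1) ≤
      (∑' n, orderCoeff δ (n + 1) * 1 ^ (n + 1)) * s := by
    rw [← tsum_mul_right]
    refine ((summable_nat_add_iff 1).2 h1).tsum_le_tsum (fun n => ?_)
      (((summable_nat_add_iff 1).2 h2).mul_right s)
    rw [one_pow, mul_one]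
    exact mul_le_mul_of_nonneg_left (pow_le_of_le_one hs hs1 (by omega)) (orderCoeff_pos δ _).le
  simp only [orderCoeff_zero, pow_zero, mul_one] at h3 ⊢
  linarith

-- Every t^n / n! with t = s^δ is at most the δ-th power of the series, so summing at t/2 gives
-- exp(t/2) ≤ 2 (series)^δ. For t ≥ 4 the factor 2 is absorbed by exp(t/4).
open Nat in
theorem exp_le_orderSeries {δ : ℝ} (hδ : 0 < δ) {s : ℝ} (hs : 0 ≤ s) (h4 : 4 ≤ s ^ δ) :
    Real.exp (s ^ δ / (4 * δ)) ≤ orderSeries δ s := by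
  have h0 : 0 ≤ orderSeries δ s := zero_le_one.trans (one_le_orderSeries hδ hs)
  set t := s ^ δ with ht
  have ht0 : 0 ≤ t := by positivity
  have hn : ∀ n : ℕ, t ^ n / n ! ≤ orderSeries δ s ^ δ := by
    intro n
    have h1 := (summable_orderCoeff hδ hs).le_tsum n
      fun n _ => mul_nonneg (orderCoeff_pos δ n).le (by positivity)
    rw [orderCoeff_mul_pow hδ hs] at h1
    have h2 := Real.rpow_le_rpow (by positivity) h1 hδ.le
    rwa [← Real.rpow_mul (by positivity), inv_mul_cancel₀ hδ.ne', Real.rpow_one] at h2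
  have hexp : Real.exp (t / 2) ≤ 2 * orderSeries δ s ^ δ := by
    have h1 : HasSum (fun n : ℕ => (t / 2) ^ n / n !) (Real.exp (t / 2)) := by
      rw [Real.exp_eq_exp_ℝ]
      exact NormedSpace.expSeries_div_hasSum_exp (t / 2)
    refine hasSum_le (fun n => ?_) h1 (hasSum_geometric_two.mul_right (orderSeries δ s ^ δ))
    rw [div_pow, div_right_comm, one_div, inv_pow, div_eq_inv_mul]
    gcongr
    exact hn n
  have h2 : 2 ≤ Real.exp (t / 4) := by
    have := Real.add_one_le_exp (t / 4)
    linarith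
  have h3 : Real.exp (t / 4) ≤ orderSeries δ s ^ δ := by
    rw [show t / 2 = t / 4 + t / 4 by ring, Real.exp_add] at hexp
    nlinarith [Real.exp_pos (t / 4)]
  have h5 := Real.rpow_le_rpow (Real.exp_pos _).le h3 (inv_nonneg.2 hδ.le)
  rw [← Real.rpow_mul h0, mul_inv_cancel₀ hδ.ne', Real.rpow_one, ← Real.exp_mul] at h5
  refine le_trans (le_of_eq ?_) h5
  congr 1
  field_simp

/-- The entire function `∑ (-z)^n / (n!)^{1/δ}`. -/
noncomputable def orderFun (δ : ℝ) (z : ℂ) : ℂ := ∑' n, (orderCoeff δ n : ℂ) * (-z) ^ n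

theorem norm_orderFun_term (δ : ℝ) (z : ℂ) (n : ℕ) :
    ‖(orderCoeff δ n : ℂ) * (-z) ^ n‖ = orderCoeff δ n * ‖z‖ ^ n := by
  rw [norm_mul, norm_pow, norm_neg, Complex.norm_real, Real.norm_of_nonneg (orderCoeff_pos δ n).le]

theorem differentiable_orderFun {δ : ℝ} (hδ : 0 < δ) : Differentiable ℂ (orderFun δ) := by
  intro z
  have hR : 0 ≤ ‖z‖ + 1 := by positivity
  refine (Complex.differentiableOn_tsum_of_summable_norm (summable_orderCoeff hδ hR)
    (U := ball 0 (‖z‖ + 1)) (fun n => by fun_prop) isOpen_ball fun n w hw => ?_).differentiableAt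
      (isOpen_ball.mem_nhds (by simp))
  rw [norm_orderFun_term]
  have := (orderCoeff_pos δ n).le
  gcongr
  exact (mem_ball_zero_iff.1 hw).le

theorem orderFun_zero (δ : ℝ) : orderFun δ 0 = 1 := by
  rw [orderFun, tsum_eq_single 0]
  · simp
  · intro n hn; simp [hn]

theorem norm_orderFun_le {δ : ℝ} (hδ : 0 < δ) (z : ℂ) : ‖orderFun δ z‖ ≤ orderSeries δ ‖z‖ := by
  have h := summable_orderCoeff hδ (norm_nonneg z)
  exact tsum_of_norm_bounded h.hasSum fun n => (norm_orderFun_term δ z n).le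

theorem orderFun_neg (δ s : ℝ) : orderFun δ (-s) = orderSeries δ s := by
  rw [orderFun, orderSeries, Complex.ofReal_tsum]
  refine tsum_congr fun n => ?_
  push_cast
  rw [neg_neg]

/-- For |w| ≤ 1 the logarithm of the bound is linear in |w|, hence controlled by |w|^min(1,δ); for
|w| ≥ 1 polynomial factors and constants are absorbed into exp of a multiple of |w|^δ. -/
theorem exists_norm_mul_orderFun_le {δ : ℝ} (hδ : 0 < δ) :
    ∃ C : ℝ, 0 ≤ C ∧ ∀ w : ℂ,
      ‖(1 - w) * orderFun δ w‖ ≤ Real.exp (C * (‖w‖ ^ min 1 δ + ‖w‖ ^ δ)) := by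
  set K := orderSeries δ 1 with hK
  have hK1 : 1 ≤ K := one_le_orderSeries hδ zero_le_one
  set A := 3 + (2 : ℝ) ^ δ / δ with hA
  have hA0 : 0 ≤ A := by positivity
  refine ⟨1 + K + A + δ⁻¹, by positivity, fun w => ?_⟩
  set s := ‖w‖ with hs
  have hs0 : 0 ≤ s := norm_nonneg w
  have h1 : ‖(1 - w) * orderFun δ w‖ ≤ (1 + s) * orderSeries δ s := by
    rw [norm_mul]
    refine mul_le_mul ((norm_sub_le _ _).trans (by rw [norm_one])) (norm_orderFun_le hδ w)
      (norm_nonneg _) (by positivity)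
  refine h1.trans ?_
  have hδ' : 0 < δ⁻¹ := inv_pos.2 hδ
  have hp1 : 0 ≤ s ^ min 1 δ := by positivity
  have hp2 : 0 ≤ s ^ δ := by positivity
  rcases le_total s 1 with h | h
  · have h2 : s ≤ s ^ min 1 δ := by
      rcases hs0.eq_or_lt with h0 | h0
      · rw [← h0]; positivity
      · simpa using Real.rpow_le_rpow_of_exponent_ge h0 h (min_le_left 1 δ)
    have h3 := orderSeries_le_of_le_one hδ hs0 h
    have h4 : 1 + s ≤ Real.exp s := by linarith [Real.add_one_le_exp s]
    have h5 : 1 + K * s ≤ Real.exp (K * s) := by linarith [Real.add_one_le_exp (K * s)]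
    calc (1 + s) * orderSeries δ s ≤ Real.exp s * Real.exp (K * s) := by
          refine mul_le_mul h4 (h3.trans h5) ?_ (Real.exp_pos _).le
          exact zero_le_one.trans (one_le_orderSeries hδ hs0)
      _ = Real.exp ((1 + K) * s) := by rw [← Real.exp_add]; ring_nf
      _ ≤ _ := Real.exp_le_exp.2 (mul_le_mul (by linarith) (by linarith) hs0 (by linarith))
  · have h2 : 1 ≤ s ^ δ := Real.one_le_rpow h hδ.le
    have h3 := orderSeries_le hδ hs0
    have h4 : s ≤ Real.exp (s ^ δ * δ⁻¹) := by
      have := Real.log_le_rpow_div hs0 hδ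
      rw [← div_eq_mul_inv]
      calc s = Real.exp (Real.log s) := (Real.exp_log (by linarith)).symm
        _ ≤ _ := Real.exp_le_exp.2 this
    have h5 : 4 ≤ Real.exp (3 * s ^ δ) := by
      linarith [Real.add_one_le_exp (3 * s ^ δ)]
    calc (1 + s) * orderSeries δ s ≤ (2 * s) * (2 * Real.exp ((2 * s) ^ δ / δ)) := by
          refine mul_le_mul (by linarith) h3 ?_ (by positivity)
          exact zero_le_one.trans (one_le_orderSeries hδ hs0)
      _ = 4 * s * Real.exp ((2 * s) ^ δ / δ) := by ring
      _ ≤ Real.exp (3 * s ^ δ) * Real.exp (s ^ δ * δ⁻¹) * Real.exp ((2 * s) ^ δ / δ) := by gcongr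
      _ = Real.exp ((A + δ⁻¹) * s ^ δ) := by
          rw [← Real.exp_add, ← Real.exp_add, Real.mul_rpow (by norm_num) hs0]
          congr 1
          rw [hA]
          ring
      _ ≤ _ := Real.exp_le_exp.2 (mul_le_mul (by linarith) (by linarith) hp2 (by positivity))

theorem exists_order {δ : ℝ} (hδ : 0 < δ) :
    ∃ d : ℂ → ℂ, IsSmoothDynamicalDeterminant d ∧ entireOrder d = (δ : EReal) := by
  have hF := differentiable_orderFun hδ
  have hF0 := orderFun_zero δ
  refine ⟨_, isSmoothDynamicalDeterminant_powProd hF hF0, le_antisymm ?_ ?_⟩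
  · obtain ⟨C, hC, h⟩ := exists_norm_mul_orderFun_le hδ
    obtain ⟨C', hC'⟩ := norm_powProd_le (D := fun w => (1 - w) * orderFun δ w) (by fun_prop)
      (by simp [hF0]) hC (lt_min zero_lt_one hδ) (min_le_right 1 δ) h
    exact entireOrder_le hδ.le hC'
  · set D : ℂ → ℂ := fun w => (1 - w) * orderFun δ w with hDdef
    have hD : Differentiable ℂ D := by fun_prop
    have hD0 : D 0 = 1 := by simp [hDdef, hF0]
    have hDs : ∀ s : ℝ, 0 ≤ s → orderSeries δ s ≤ ‖D (-s)‖ := by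
      intro s hs
      have h0 := one_le_orderSeries hδ hs
      have h1 : D (-s) = (((1 + s) * orderSeries δ s : ℝ) : ℂ) := by
        simp [hDdef, orderFun_neg]
      rw [h1, Complex.norm_real, Real.norm_of_nonneg (by positivity)]
      exact le_mul_of_one_le_left (by linarith) (by linarith)
    -- The constant comes from the bound exp(s^δ / (4δ)) at s = r/9, the argument of the factor k =
    -- 1.
    refine le_entireOrder (differentiable_powProd hD hD0).continuous
      (c := (9 ^ δ * (4 * δ))⁻¹) (by positivity) ?_
    filter_upwards [eventually_ge_atTop 0,
      (tendsto_rpow_atTop hδ).eventually_ge_atTop (4 * 9 ^ δ)] with r hr h2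
    refine ⟨-r, by simp [abs_of_nonneg hr], ?_⟩
    have h3 : (r / 9) ^ δ = r ^ δ / 9 ^ δ := Real.div_rpow hr (by norm_num) _
    have h4 : 4 ≤ (r / 9) ^ δ := by rwa [h3, le_div_iff₀ (by positivity)]
    have h5 := exp_le_orderSeries hδ (by positivity) h4
    rw [h3, div_div, div_eq_inv_mul] at h5
    exact (h5.trans (hDs _ (by positivity))).trans (le_norm_powProd hD hD0
      (fun s hs => (one_le_orderSeries hδ hs).trans (hDs s hs)) hr)

end Horseshoe

theorem corollary3p4 :
    (∀ γ : ℕ∞, ∃ d : ℂ → ℂ, IsSmoothDynamicalDeterminant d ∧ HasGenus d γ) ∧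
    (∀ δ : ℝ, 0 < δ → (∀ n : ℕ, δ ≠ n) →
      ∃ d : ℂ → ℂ, IsSmoothDynamicalDeterminant d ∧ entireOrder d = (δ : EReal)) := by
  refine ⟨fun γ => ?_, fun δ hδ _ => Horseshoe.exists_order hδ⟩
  cases γ with
  | top => exact Horseshoe.exists_genus_top
  | coe n =>
    cases n with
    | zero => exact Horseshoe.exists_genus_zero
    | succ n => exact Horseshoe.exists_genus_succ n
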